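/- **Setting.** Let $(V,Q)$ be a non-degenerate finite-dimensional rational quadratic space of signature $(b^+,b^-)$ with bilinear form $(X,Y)=Q(X+Y)-Q(X)-Q(Y)$, let $L\subset V$ be an even lattice of full rank (i.e. $Q(L)\subset\mathbb Z$), $L'$ its dual lattice, and $(\mathfrak e_\gamma)_{\gamma\in L'/L}$ the standard basis of $\mathbb C[L'/L]$. Write $e(z)=e^{2\pi i z}$ and $\tau=x+iy\in\mathbb H$. Let $\mathrm{Mp}_2(\mathbb Z)$ be the group of pairs $(M,\phi)$ with $M=\begin{pmatrix}a&b\\c&d\end{pmatrix}\in\mathrm{SL}_2(\mathbb Z)$ and $\phi:\mathbb H\to\mathbb C$ holomorphic with $\phi(\tau)^2=c\tau+d$, with product $(M,\phi(\tau))(M',\phi'(\tau))=(MM',\phi(M'\tau)\phi'(\tau))$. It is generated by $T=\left(\begin{pmatrix}1&1\\0&1\end{pmatrix},1\right)$ and $S=\left(\begin{pmatrix}0&-1\\1&0\end{pmatrix},\sqrt\tau\right)$. The Weil representation $\rho_L$ is the unitary representation of $\mathrm{Mp}_2(\mathbb Z)$ on $\mathbb C[L'/L]$ with $$\rho_L(T)\mathfrak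 e_\gamma=e(Q(\gamma))\mathfrak e_\gamma,\qquad \rho_L(S)\mathfrak e_\gamma=\frac{e((b^--b^+)/8)}{\sqrt{|L'/L|}}\sum_{\delta\in L'/L}e(-(\gamma,\delta))\mathfrak e_\delta ,$$ and $\bar\rho_L$ is its dual representation. Let $\rho\in\{\rho_L,\bar\rho_L\}$, and put $Q_\rho=Q$ if $\rho=\rho_L$, $Q_\rho=-Q$ if $\rho=\bar\rho_L$. For an integer $k$, let $H_{k,\rho}$ be the space of smooth $f:\mathbb H\to\mathbb C[L'/L]$ such that (i) $f(M\tau)=\phi(\tau)^{2k}\rho(M,\phi)f(\tau)$ for all $(M,\phi)\in\mathrm{Mp}_2(\mathbb Z)$; (ii) $\Delta_kf=0$, where $\Delta_k=-y^2\left(\frac{\partial^2}{\partial x^2}+\frac{\partial^2}{\partial y^2}\right)+iky\left(\frac{\partial}{\partial x}+i\frac{\partial}{\partial y}\right)$; (iii) there is a finite sum $P_f(\tau)=\sum_{\gamma}\sum_{n\in\mathbb Z+Q_\rho(\gamma),\,n\le0}c(\gamma,n)e(n\tau)\mathfrak e_\gamma$ with $f(\tau)=P_f(\tau)+O(e^{-\varepsilon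 y})$ as $y\to\infty$, uniformly in $x$, for some $\varepsilon>0$. Let $M^!_{k,\rho}$ be the space of holomorphic $g:\mathbb H\to\mathbb C[L'/L]$ satisfying (i) and having a Fourier expansion $$g(\tau)=\sum_{\gamma}\sum_{n\in\mathbb Z+Q_\rho(\gamma),\ n\gg-\infty}c_g(\gamma,n)e(n\tau)\mathfrak e_\gamma .$$ Let $D=\frac1{2\pi i}\frac{\partial}{\partial\tau}$ with $\frac{\partial}{\partial\tau}=\frac12\left(\frac{\partial}{\partial x}-i\frac{\partial}{\partial y}\right)$, and $\Gamma(a,x)=\int_x^\infty e^{-t}t^{a-1}\,dt$. **Theorem.** Let $k\le0$ be an integer, $f\in H_{k,\rho_L}$ and $g\in D^{1-k}(H_{k,\bar\rho_L})$. Then $g\in M^!_{2-k,\bar\rho_L}$, the form $f$ has a decomposition $$f(\tau)=\sum_{\gamma}\sum_{n\in\mathbb Z+Q(\gamma),\ n\gg-\infty}c_f^+(\gamma,n)e(n\tau)\mathfrak e_\gamma+\sum_{\gamma}\sum_{n\in\mathbb Z+Q(\gamma),\ n<0}c_f^-(\gamma,n)\Gamma(1-k,4\pi|n|y)e(n\tau)\mathfrak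 e_\gamma ,$$ and for the coefficients $c_f^+$ of any such decomposition and the Fourier coefficients $c_g$ of $g$ one has $$\sum_{\gamma\in L'/L}\ \sum_{m+n=0}c_f^+(\gamma,m)\,c_g(\gamma,n)=0 .$$ (The inner sum has only finitely many non-zero terms.) -/

import Mathlib

open scoped MatrixGroups UpperHalfPlane Manifold ContDiff Asymptotics
open UpperHalfPlane

noncomputable section

/-- The integral metaplectic group `Mp₂(ℤ)`: pairs `(M, φ)` with `M ∈ SL₂(ℤ)` and
`φ : ℍ → ℂ` holomorphic such that `φ(τ)² = cτ + d`. -/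
@[ext]
structure Mp2Z where
  mat : SL(2, ℤ)
  phi : ℍ → ℂ
  holo : MDifferentiable 𝓘(ℂ) 𝓘(ℂ) phi
  sq : ∀ τ : ℍ, phi τ ^ 2 = denom mat τ

namespace Mp2Z

theorem phi_ne_zero (g : Mp2Z) (τ : ℍ) : g.phi τ ≠ 0 := by
  intro h
  have := g.sq τ
  rw [h] at this
  exact denom_ne_zero _ τ (by rw [← this]; ring)

theorem mdiff_smul (M : SL(2, ℤ)) : MDifferentiable 𝓘(ℂ) 𝓘(ℂ) (fun τ : ℍ => M • τ) :=
  mdifferentiable_smul (g := (M : GL (Fin 2) ℝ)) (by simp)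

theorem denom_mul (M N : SL(2, ℤ)) (τ : ℍ) :
    denom (M * N : SL(2, ℤ)) τ = denom M ↑(N • τ) * denom N τ := by
  have := denom_cocycle_σ (M : GL (Fin 2) ℝ) (N : GL (Fin 2) ℝ) τ
  rw [σ, if_pos (by simp)] at this
  simpa using this

/-- `(M, φ(τ)) (M', φ'(τ)) = (M M', φ(M'τ) φ'(τ))`. -/
instance : Mul Mp2Z where
  mul g h :=
    { mat := g.mat * h.mat
      phi := fun τ => g.phi (h.mat • τ) * h.phi τ
      holo := (g.holo.comp (mdiff_smul h.mat)).mul h.holo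
      sq := fun τ => by rw [mul_pow, g.sq, h.sq, denom_mul] }

instance : One Mp2Z where
  one :=
    { mat := 1
      phi := fun _ => 1
      holo := mdifferentiable_const
      sq := fun τ => by simp [denom] }

instance : Inv Mp2Z where
  inv g :=
    { mat := g.mat⁻¹
      phi := fun τ => (g.phi (g.mat⁻¹ • τ))⁻¹
      holo := by
        have h := g.holo.comp (mdiff_smul g.mat⁻¹)
        rw [mdifferentiable_iff] at h ⊢
        exact h.inv fun z _ => g.phi_ne_zero _
      sq := fun τ => by
        have h := denom_mul g.mat g.mat⁻¹ τ
        rw [mul_inv_cancel] at h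
        have h1 : denom ((1 : SL(2, ℤ)) : GL (Fin 2) ℝ) τ = 1 := by simp [denom]
        rw [h1] at h
        rw [inv_pow, g.sq]
        exact (eq_inv_of_mul_eq_one_right h.symm).symm }

theorem mul_mat (g h : Mp2Z) : (g * h).mat = g.mat * h.mat := rfl
theorem mul_phi (g h : Mp2Z) (τ : ℍ) : (g * h).phi τ = g.phi (h.mat • τ) * h.phi τ := rfl
theorem one_mat : (1 : Mp2Z).mat = 1 := rfl
theorem one_phi (τ : ℍ) : (1 : Mp2Z).phi τ = 1 := rfl
theorem inv_mat (g : Mp2Z) : g⁻¹.mat = g.mat⁻¹ := rfl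
theorem inv_phi (g : Mp2Z) (τ : ℍ) : g⁻¹.phi τ = (g.phi (g.mat⁻¹ • τ))⁻¹ := rfl

instance : Group Mp2Z :=
  Group.ofLeftAxioms
    (fun a b c => by
      ext τ
      · simp only [mul_mat, mul_assoc]
      · simp only [mul_phi, mul_mat, mul_assoc, mul_smul])
    (fun a => by
      ext τ
      · simp only [mul_mat, one_mat, one_mul]
      · simp only [mul_phi, one_phi, one_mul])
    (fun a => by
      ext τ
      · simp only [mul_mat, inv_mat, one_mat, inv_mul_cancel]
      · simp only [mul_phi, inv_phi, one_phi, inv_smul_smul]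
        exact inv_mul_cancel₀ (a.phi_ne_zero τ))

/-- `T = ((1 1; 0 1), 1)`. -/
def T : Mp2Z where
  mat := ModularGroup.T
  phi := fun _ => 1
  holo := mdifferentiable_const
  sq := fun τ => by simp [denom, ModularGroup.coe_T]

/-- `S = ((0 -1; 1 0), √τ)`, with the principal branch of the square root. -/
def S : Mp2Z where
  mat := ModularGroup.S
  phi := fun τ => (τ : ℂ) ^ (1 / 2 : ℂ)
  holo := by
    rw [mdifferentiable_iff]
    intro z hz
    have h : DifferentiableAt ℂ (fun w : ℂ => w ^ (1 / 2 : ℂ)) z :=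
      differentiableAt_id.cpow_const (Or.inr (ne_of_gt hz))
    refine (h.differentiableWithinAt).congr (fun w hw => ?_) ?_
    · simp [Function.comp, ofComplex_apply_of_im_pos hw]
    · simp [Function.comp, ofComplex_apply_of_im_pos hz]
  sq := fun τ => by
    rw [← Complex.cpow_nat_mul]
    simp [denom, ModularGroup.coe_S]

theorem closure_S_T : Subgroup.closure {S, T} = (⊤ : Subgroup Mp2Z) := by
  have hS2 : ∀ τ : ℍ, (S * S).mat • τ = τ := fun τ => by
    have h : (S * S).mat = -1 := by
      rw [mul_mat]
      ext i j
      fin_cases i <;> fin_cases j <;> simp [S, ModularGroup.coe_S, Matrix.mul_apply]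
    rw [h, ModularGroup.SL_neg_smul, one_smul]
  have hS4 : ∀ τ : ℍ, ((S * S) * (S * S)).phi τ = -1 := fun τ => by
    rw [mul_phi, hS2, ← pow_two, (S * S).sq, mul_mat]
    simp [S, denom, ModularGroup.coe_S, Matrix.mul_apply]
  have hS4' : ((S * S) * (S * S)).mat = 1 := by
    simp only [mul_mat]
    ext i j
    fin_cases i <;> fin_cases j <;> simp [S, ModularGroup.coe_S, Matrix.mul_apply]
  have hSm : S ∈ Subgroup.closure {S, T} := Subgroup.subset_closure (by simp)
  have hTm : T ∈ Subgroup.closure {S, T} := Subgroup.subset_closure (by simp)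
  let π : Mp2Z →* SL(2, ℤ) := ⟨⟨Mp2Z.mat, rfl⟩, fun _ _ => rfl⟩
  have hπ : (Subgroup.closure {S, T}).map π = ⊤ := by
    rw [MonoidHom.map_closure, Set.image_pair]
    exact SpecialLinearGroup.SL2Z_generators
  rw [eq_top_iff]
  intro g _
  obtain ⟨h, hh, hgh⟩ : g.mat ∈ (Subgroup.closure {S, T}).map π := by rw [hπ]; trivial
  have hmat : h.mat = g.mat := hgh
  have hsq : Set.EqOn (g.phi ^ 2) (h.phi ^ 2) Set.univ := fun τ _ => by
    simp only [Pi.pow_apply, g.sq, h.sq, hmat]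
  rcases isPreconnected_univ.eq_or_eq_neg_of_sq_eq g.holo.continuous.continuousOn
    h.holo.continuous.continuousOn hsq (fun {τ} _ => h.phi_ne_zero τ) with e | e
  · have : g = h := by
      ext1
      · exact hmat.symm
      · exact funext fun τ => e (Set.mem_univ τ)
    rwa [this]
  · have : g = ((S * S) * (S * S)) * h := by
      ext1
      · rw [mul_mat, hS4', one_mul, hmat]
      · funext τ
        rw [mul_phi, hS4, e (Set.mem_univ τ)]
        simp
    rw [this]
    exact mul_mem (mul_mem (mul_mem hSm hSm) (mul_mem hSm hSm)) hh

end Mp2Z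

/-- `e(x) = exp(2πix)` for rational `x`. -/
def expUnit (x : ℚ) : ℂ := Complex.exp (2 * Real.pi * Complex.I * (x : ℂ))

theorem expUnit_add (x y : ℚ) : expUnit (x + y) = expUnit x * expUnit y := by
  rw [expUnit, expUnit, expUnit, ← Complex.exp_add]; push_cast; ring_nf

theorem expUnit_neg (x : ℚ) : expUnit (-x) = star (expUnit x) := by
  rw [expUnit, expUnit, Complex.star_def, ← Complex.exp_conj]
  congr 1
  simp only [map_mul, Complex.conj_ofReal, Complex.conj_I, map_ratCast, Rat.cast_neg, map_ofNat]
  ring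

theorem expUnit_eq_one_iff (x : ℚ) : expUnit x = 1 ↔ ∃ n : ℤ, x = n := by
  rw [expUnit, Complex.exp_eq_one_iff]
  refine exists_congr fun n => ?_
  have h : (2 * Real.pi * Complex.I : ℂ) ≠ 0 := Complex.two_pi_I_ne_zero
  rw [mul_comm (n : ℂ), mul_right_inj' h]
  exact_mod_cast Iff.rfl

theorem expUnit_zero : expUnit 0 = 1 := by simp [expUnit]

theorem expUnit_mul_star (x : ℚ) : expUnit x * star (expUnit x) = 1 := by
  rw [← expUnit_neg, ← expUnit_add, add_neg_cancel, expUnit_zero]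

/-- A full even lattice `L` in a non-degenerate rational quadratic space `(V, Q)`;
evenness means that `Q` is integral on `L`. The bilinear form is
`(x, y) = Q(x + y) - Q(x) - Q(y)`. -/
structure EvenLattice (V : Type*) [AddCommGroup V] [Module ℚ V] where
  Q : QuadraticForm ℚ V
  L : Submodule ℤ V
  nondegenerate : Q.polarBilin.Nondegenerate
  fg : L.FG
  span_eq_top : Submodule.span ℚ (L : Set V) = ⊤
  even : ∀ x ∈ L, ∃ n : ℤ, Q x = n

namespace EvenLattice

variable {V : Type*} [AddCommGroup V] [Module ℚ V] (Λ : EvenLattice V)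

/-- The bilinear form `(x, y) = Q(x + y) - Q(x) - Q(y)`. -/
def pair (x y : V) : ℚ := QuadraticMap.polar Λ.Q x y

/-- The dual lattice `L'`. -/
def dual : Submodule ℤ V := LinearMap.BilinForm.dualSubmodule Λ.Q.polarBilin Λ.L

/-- The discriminant group `L'/L`. -/
abbrev Disc : Type _ := Λ.dual ⧸ Λ.L.submoduleOf Λ.dual

theorem mem_dual {x : V} : x ∈ Λ.dual ↔ ∀ y ∈ Λ.L, ∃ n : ℤ, Λ.pair x y = n := by
  refine forall₂_congr fun y _ => ?_
  rw [Submodule.mem_one]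
  exact exists_congr fun n => by simp [pair, eq_comm]

theorem pair_add_left (x x' y : V) : Λ.pair (x + x') y = Λ.pair x y + Λ.pair x' y :=
  QuadraticMap.polar_add_left Λ.Q x x' y

theorem pair_comm (x y : V) : Λ.pair x y = Λ.pair y x := QuadraticMap.polar_comm Λ.Q x y

theorem pair_add_right (x y y' : V) : Λ.pair x (y + y') = Λ.pair x y + Λ.pair x y' :=
  QuadraticMap.polar_add_right Λ.Q x y y'

theorem le_dual : Λ.L ≤ Λ.dual := fun x hx => by
  rw [mem_dual]
  intro y hy
  obtain ⟨a, ha⟩ := Λ.even _ (add_mem hx hy)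
  obtain ⟨b, hb⟩ := Λ.even _ hx
  obtain ⟨c, hc⟩ := Λ.even _ hy
  exact ⟨a - b - c, by simp [pair, QuadraticMap.polar, ha, hb, hc]⟩

theorem exists_basis : ∃ (n : ℕ) (b : Module.Basis (Fin n) ℚ V),
    Submodule.span ℤ (Set.range b) = Λ.L := by
  have : Module.Finite ℤ Λ.L := Module.Finite.iff_fg.mpr Λ.fg
  have : IsAddTorsionFree V := .of_module_rat V
  have : Module.IsTorsionFree ℤ V := inferInstance
  have : Module.Free ℤ Λ.L := inferInstance
  let b := Module.finBasis ℤ Λ.L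
  have hspan : Submodule.span ℤ (Set.range fun i => (b i : V)) = Λ.L := by
    have := congrArg (Submodule.map Λ.L.subtype) b.span_eq
    rw [Submodule.map_span, ← Set.range_comp, Submodule.map_top, Submodule.range_subtype] at this
    exact this
  have hli : LinearIndependent ℚ fun i => (b i : V) := by
    rw [← LinearIndependent.iff_fractionRing ℤ ℚ]
    exact b.linearIndependent.map' Λ.L.subtype (Submodule.ker_subtype _)
  have hsp : ⊤ ≤ Submodule.span ℚ (Set.range fun i => (b i : V)) := by
    rw [← Submodule.span_span_of_tower ℤ, hspan, Λ.span_eq_top]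
  refine ⟨_, Module.Basis.mk hli hsp, ?_⟩
  rw [Module.Basis.coe_mk, hspan]

theorem mem_of_pair_dual {x : V} (h : ∀ y ∈ Λ.dual, ∃ n : ℤ, Λ.pair x y = n) : x ∈ Λ.L := by
  obtain ⟨n, b, hb⟩ := Λ.exists_basis
  have hs : LinearMap.BilinForm.IsSymm Λ.Q.polarBilin :=
    ⟨fun x y => by simpa using! QuadraticMap.polar_comm Λ.Q x y⟩
  have := LinearMap.BilinForm.dualSubmodule_dualSubmodule_of_basis (R := ℤ)
    Λ.Q.polarBilin Λ.nondegenerate hs b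
  rw [hb] at this
  rw [← this]
  intro y hy
  obtain ⟨m, hm⟩ := h y hy
  exact Submodule.mem_one.mpr ⟨m, by simpa [pair] using! hm.symm⟩

instance : Finite Λ.Disc := by
  obtain ⟨n, b, hb⟩ := Λ.exists_basis
  have hfg : Λ.dual.FG := by
    rw [dual, ← hb, LinearMap.BilinForm.dualSubmodule_span_of_basis Λ.Q.polarBilin Λ.nondegenerate b]
    exact Submodule.fg_span (Set.finite_range _)
  have : Module.Finite ℤ Λ.dual := Module.Finite.iff_fg.mpr hfg
  have key : ∀ x : V, ∃ m : ℤ, m ≠ 0 ∧ m • x ∈ Λ.L := fun x => by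
    have hx : x ∈ Submodule.span ℚ (Λ.L : Set V) := by rw [Λ.span_eq_top]; trivial
    induction hx using Submodule.span_induction with
    | mem x hx => exact ⟨1, one_ne_zero, by simpa using hx⟩
    | zero => exact ⟨1, one_ne_zero, by simp⟩
    | add x y _ _ hx hy =>
      obtain ⟨m, hm, hmx⟩ := hx
      obtain ⟨l, hl, hly⟩ := hy
      refine ⟨m * l, mul_ne_zero hm hl, ?_⟩
      rw [smul_add]
      refine add_mem ?_ ?_
      · rw [mul_comm, mul_smul]; exact Λ.L.smul_mem l hmx
      · rw [mul_smul]; exact Λ.L.smul_mem m hly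
    | smul a x _ hx =>
      obtain ⟨m, hm, hmx⟩ := hx
      refine ⟨m * a.den, mul_ne_zero hm (by exact_mod_cast a.den_ne_zero), ?_⟩
      have : (m * (a.den : ℤ)) • a • x = a.num • m • x := by
        rw [← Int.cast_smul_eq_zsmul ℚ, ← Int.cast_smul_eq_zsmul ℚ a.num,
          ← Int.cast_smul_eq_zsmul ℚ m, smul_smul, smul_smul]
        congr 1
        push_cast
        rw [mul_assoc, mul_comm (a.den : ℚ), Rat.mul_den_eq_num]
        ring
      rw [this]
      exact Λ.L.smul_mem _ hmx
  refine Module.finite_of_fg_torsion _ fun {γ} => ?_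
  induction γ using Submodule.Quotient.induction_on with
  | H x =>
    obtain ⟨m, hm, hmx⟩ := key x
    refine ⟨⟨m, mem_nonZeroDivisors_of_ne_zero hm⟩, ?_⟩
    change m • (Submodule.Quotient.mk x : Λ.Disc) = 0
    rw [← Submodule.Quotient.mk_smul, Submodule.Quotient.mk_eq_zero]
    exact hmx

instance : Fintype Λ.Disc := Fintype.ofFinite _

instance : DecidableEq Λ.Disc := Classical.decEq _

/-- A representative in `L'` of a class in `L'/L`. -/
def rep (γ : Λ.Disc) : V := (Quotient.out γ : Λ.dual)

theorem rep_mem (γ : Λ.Disc) : Λ.rep γ ∈ Λ.dual := (Quotient.out γ : Λ.dual).2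

theorem mk_rep (γ : Λ.Disc) : (Submodule.Quotient.mk ⟨Λ.rep γ, Λ.rep_mem γ⟩ : Λ.Disc) = γ :=
  Quotient.out_eq γ

theorem rep_sub_mem (x : Λ.dual) :
    Λ.rep (Submodule.Quotient.mk x) - x ∈ Λ.L := by
  have h := Λ.mk_rep (Submodule.Quotient.mk x)
  rw [Submodule.Quotient.eq] at h
  exact h

/-- `Q(γ)` for `γ ∈ L'/L`, computed on a representative; it matters only modulo `ℤ`, where it
does not depend on the representative (`q_mk`). -/
def q (γ : Λ.Disc) : ℚ := Λ.Q (Λ.rep γ)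

theorem q_mk (x : Λ.dual) : ∃ n : ℤ, Λ.q (Submodule.Quotient.mk x) = Λ.Q x + n := by
  have h := Λ.rep_sub_mem x
  obtain ⟨a, ha⟩ := Λ.even _ h
  obtain ⟨b, hb⟩ := Λ.mem_dual.mp x.2 _ h
  refine ⟨a + b, ?_⟩
  have := QuadraticMap.map_add Λ.Q (x : V) (Λ.rep (Submodule.Quotient.mk x) - x)
  rw [add_sub_cancel, ha] at this
  rw [pair] at hb
  rw [q, this, hb]
  push_cast
  ring

/-- `e((γ, δ))` for `γ, δ ∈ L'/L`; it does not depend on representatives (`ePair_mk`). -/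
def ePair (γ δ : Λ.Disc) : ℂ := expUnit (Λ.pair (Λ.rep γ) (Λ.rep δ))

theorem expUnit_pair_congr {x x' y : V} (hy : y ∈ Λ.dual) (h : x - x' ∈ Λ.L) :
    expUnit (Λ.pair x y) = expUnit (Λ.pair x' y) := by
  obtain ⟨n, hn⟩ := Λ.mem_dual.mp hy _ h
  rw [← sub_add_cancel x x', pair_add_left, expUnit_add, Λ.pair_comm (x - x'),
    (expUnit_eq_one_iff _).mpr ⟨n, hn⟩, one_mul]

theorem ePair_mk (x y : Λ.dual) :
    Λ.ePair (Submodule.Quotient.mk x) (Submodule.Quotient.mk y) = expUnit (Λ.pair x y) := by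
  rw [ePair, Λ.expUnit_pair_congr (Λ.rep_mem _) (Λ.rep_sub_mem x), Λ.pair_comm,
    Λ.expUnit_pair_congr x.2 (Λ.rep_sub_mem y), Λ.pair_comm]

theorem ePair_comm (γ δ : Λ.Disc) : Λ.ePair γ δ = Λ.ePair δ γ := by
  rw [ePair, ePair, pair_comm]

theorem ePair_add_right (γ δ ε : Λ.Disc) :
    Λ.ePair γ (δ + ε) = Λ.ePair γ δ * Λ.ePair γ ε := by
  induction γ using Submodule.Quotient.induction_on with | H x =>
  induction δ using Submodule.Quotient.induction_on with | H y =>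
  induction ε using Submodule.Quotient.induction_on with | H z =>
  rw [← Submodule.Quotient.mk_add, ePair_mk, ePair_mk, ePair_mk, Submodule.coe_add,
    pair_add_right, expUnit_add]

theorem ePair_mul_star (γ δ : Λ.Disc) : Λ.ePair γ δ * star (Λ.ePair γ δ) = 1 :=
  expUnit_mul_star _

theorem sum_ePair (γ γ' : Λ.Disc) :
    ∑ δ, star (Λ.ePair γ δ) * Λ.ePair γ' δ = if γ = γ' then (Fintype.card Λ.Disc : ℂ) else 0 := by
  split_ifs with h
  · subst h
    rw [Finset.sum_congr rfl fun δ _ => (mul_comm _ _).trans (Λ.ePair_mul_star γ δ)]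
    simp
  · let F : Λ.Disc → ℂ := fun δ => star (Λ.ePair γ δ) * Λ.ePair γ' δ
    have hF : ∀ δ ε, F (δ + ε) = F δ * F ε := fun δ ε => by
      simp only [F, ePair_add_right, star_mul']; ring
    obtain ⟨δ, hδ⟩ : ∃ δ, F δ ≠ 1 := by
      by_contra! hall
      apply h
      induction γ using Submodule.Quotient.induction_on with | H x =>
      induction γ' using Submodule.Quotient.induction_on with | H x' =>
      rw [eq_comm, Submodule.Quotient.eq]
      change (x' : V) - x ∈ Λ.L
      refine Λ.mem_of_pair_dual fun y hy => ?_
      have := hall (Submodule.Quotient.mk ⟨y, hy⟩)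
      simp only [F, ePair_mk] at this
      rw [← expUnit_neg, ← expUnit_add, expUnit_eq_one_iff] at this
      obtain ⟨n, hn⟩ := this
      refine ⟨n, ?_⟩
      rw [← hn]
      simp [pair, sub_eq_add_neg, QuadraticMap.polar_add_left, QuadraticMap.polar_neg_left]
      ring
    have hsum : F δ * ∑ ε, F ε = ∑ ε, F ε := by
      rw [Finset.mul_sum, ← Equiv.sum_comp (Equiv.addLeft δ) F]
      exact Finset.sum_congr rfl fun ε _ => (hF δ ε).symm
    have : (F δ - 1) * ∑ ε, F ε = 0 := by rw [sub_mul, hsum, one_mul, sub_self]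
    exact (mul_eq_zero.mp this).resolve_left (sub_ne_zero.mpr hδ)

/-- `ρ_L(T)`: the diagonal matrix `𝔢_γ ↦ e(Q(γ)) 𝔢_γ`. -/
def weilT : Matrix.unitaryGroup Λ.Disc ℂ :=
  ⟨Matrix.diagonal fun γ => expUnit (Λ.q γ), by
    rw [Matrix.mem_unitaryGroup_iff, Matrix.star_eq_conjTranspose, Matrix.diagonal_conjTranspose,
      Matrix.diagonal_mul_diagonal, ← Matrix.diagonal_one]
    exact congrArg _ (funext fun γ => expUnit_mul_star _)⟩

/-- The matrix of `ρ_L(S)`: its column `γ` is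
`ρ_L(S) 𝔢_γ = e((b⁻ - b⁺)/8) / √|L'/L| · ∑_δ e(-(γ, δ)) 𝔢_δ`. -/
def weilSMatrix : Matrix Λ.Disc Λ.Disc ℂ := Matrix.of fun δ γ =>
  expUnit (((sigNeg Λ.Q : ℚ) - (sigPos Λ.Q : ℚ)) / 8) / (Real.sqrt (Fintype.card Λ.Disc) : ℂ)
    * expUnit (-Λ.pair (Λ.rep γ) (Λ.rep δ))

theorem weilSMatrix_mem : Λ.weilSMatrix ∈ Matrix.unitaryGroup Λ.Disc ℂ := by
  rw [Matrix.mem_unitaryGroup_iff, Matrix.star_eq_conjTranspose]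
  have hN : ((Real.sqrt (Fintype.card Λ.Disc) : ℝ) : ℂ) * (Real.sqrt (Fintype.card Λ.Disc) : ℝ)
      = Fintype.card Λ.Disc := by
    rw [← Complex.ofReal_mul, Real.mul_self_sqrt (Nat.cast_nonneg _)]; simp
  have h0 : (Fintype.card Λ.Disc : ℂ) ≠ 0 := Nat.cast_ne_zero.mpr Fintype.card_ne_zero
  set c := expUnit (((sigNeg Λ.Q : ℚ) - (sigPos Λ.Q : ℚ)) / 8) with hc
  set r : ℂ := ((Real.sqrt (Fintype.card Λ.Disc) : ℝ) : ℂ) with hr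
  have hcc : c * star c = 1 := expUnit_mul_star _
  have hrr : star r = r := Complex.conj_ofReal _
  have hE : ∀ a b, expUnit (-Λ.pair (Λ.rep a) (Λ.rep b)) = star (Λ.ePair a b) :=
    fun _ _ => expUnit_neg _
  ext δ δ'
  rw [Matrix.mul_apply]
  have : ∀ γ, Λ.weilSMatrix δ γ * (Λ.weilSMatrix.conjTranspose) γ δ' =
      (Fintype.card Λ.Disc : ℂ)⁻¹ * (star (Λ.ePair δ γ) * Λ.ePair δ' γ) := fun γ => by
    simp only [weilSMatrix, Matrix.conjTranspose_apply, Matrix.of_apply, ← hc, ← hr, star_mul',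
      hE,
      star_div₀, star_star, hrr, Λ.ePair_comm γ]
    rw [← hN]
    calc _ = (c * star c) * (r * r)⁻¹ * (star (Λ.ePair δ γ) * Λ.ePair δ' γ) := by
          rw [mul_inv]; ring
      _ = _ := by rw [hcc, one_mul]
  rw [Finset.sum_congr rfl fun γ _ => this γ, ← Finset.mul_sum, sum_ePair, Matrix.one_apply]
  split_ifs
  · exact inv_mul_cancel₀ h0
  · simp

/-- `ρ_L(S)` as a unitary matrix. -/
def weilS : Matrix.unitaryGroup Λ.Disc ℂ := ⟨Λ.weilSMatrix, Λ.weilSMatrix_mem⟩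

/-- The graph of the Weil representation `ρ_L : Mp₂(ℤ) → U(ℂ[L'/L])`. Since `S` and `T` generate
`Mp₂(ℤ)`, the graph of the homomorphism with the given values `ρ_L(T)` and `ρ_L(S)` is the subgroup
of the product generated by `(T, ρ_L(T))` and `(S, ρ_L(S))`. -/
def weilGraph : Subgroup (Mp2Z × Matrix.unitaryGroup Λ.Disc ℂ) :=
  Subgroup.closure {(Mp2Z.T, Λ.weilT), (Mp2Z.S, Λ.weilS)}

theorem exists_mem_weilGraph (g : Mp2Z) : ∃ U, (g, U) ∈ Λ.weilGraph := by
  have h : Λ.weilGraph.map (MonoidHom.fst _ _) = ⊤ := by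
    rw [weilGraph, MonoidHom.map_closure, Set.image_pair, Set.pair_comm]
    exact Mp2Z.closure_S_T
  obtain ⟨⟨g', U⟩, hU, rfl⟩ : g ∈ Λ.weilGraph.map (MonoidHom.fst _ _) := by rw [h]; trivial
  exact ⟨U, hU⟩

/-- `A = ρ_L(g)`. -/
def WeilRel (g : Mp2Z) (A : Matrix Λ.Disc Λ.Disc ℂ) : Prop :=
  ∃ U, (g, U) ∈ Λ.weilGraph ∧ A = (U : Matrix Λ.Disc Λ.Disc ℂ)

/-- `A = ρ̄_L(g)` for the dual representation `ρ̄_L(g) = ρ_L(g⁻¹)ᵗ`, written in the basis dual to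
`(𝔢_γ)`, which is again denoted by `(𝔢_γ)`. As `ρ_L` is unitary, this is the entrywise complex
conjugate of `ρ_L(g)`. -/
def DualWeilRel (g : Mp2Z) (A : Matrix Λ.Disc Λ.Disc ℂ) : Prop :=
  ∃ U, (g, U) ∈ Λ.weilGraph ∧ A = ((U⁻¹ : Matrix.unitaryGroup Λ.Disc ℂ) :
    Matrix Λ.Disc Λ.Disc ℂ).transpose

end EvenLattice

/-! ### Vector valued forms

A function `f = ∑_γ f_γ 𝔢_γ : ℍ → ℂ[L'/L]` is given by its components, `f τ γ = f_γ(τ)`.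
The type of a form is given by a relation `R g A` (meaning `A = ρ(g)`), together with
`q : L'/L → ℚ` such that the exponents of the component `γ` lie in `ℤ + q(γ)`. -/

/-- `∂F/∂x`. -/
def partialX (F : ℍ → ℂ) : ℍ → ℂ := fun τ => fderiv ℝ (F ∘ ofComplex) (τ : ℂ) 1

/-- `∂F/∂y`. -/
def partialY (F : ℍ → ℂ) : ℍ → ℂ := fun τ => fderiv ℝ (F ∘ ofComplex) (τ : ℂ) Complex.I

/-- `Δ_k = -y² (∂²/∂x² + ∂²/∂y²) + i k y (∂/∂x + i ∂/∂y)`. -/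
def hypLaplacian (k : ℤ) (F : ℍ → ℂ) : ℍ → ℂ := fun τ =>
  -(τ.im : ℂ) ^ 2 * (partialX (partialX F) τ + partialY (partialY F) τ)
    + Complex.I * k * τ.im * (partialX F τ + Complex.I * partialY F τ)

/-- `e(nτ) = exp(2πinτ)`. -/
def expTau (n : ℚ) (τ : ℍ) : ℂ := Complex.exp (2 * Real.pi * Complex.I * (n : ℂ) * (τ : ℂ))

/-- The incomplete Gamma function `Γ(a, x) = ∫_x^∞ e^{-t} t^{a-1} dt`. -/
def incGamma (a x : ℝ) : ℝ := ∫ t in Set.Ioi x, Real.exp (-t) * t ^ (a - 1)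

section VectorValued

variable {D : Type*} [Fintype D]

/-- `D = (1 / 2πi) d/dτ`, where `d/dτ = (∂/∂x - i ∂/∂y) / 2`, applied to each component. -/
def opD (f : ℍ → D → ℂ) : ℍ → D → ℂ := fun τ γ =>
  1 / (2 * Real.pi * Complex.I) *
    ((partialX (fun z => f z γ) τ - Complex.I * partialY (fun z => f z γ) τ) / 2)

/-- `f(Mτ) = φ(τ)^{2k} ρ(M, φ) f(τ)` for all `(M, φ) ∈ Mp₂(ℤ)`. -/
def IsModular (R : Mp2Z → Matrix D D ℂ → Prop) (k : ℤ) (f : ℍ → D → ℂ) : Prop :=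
  ∀ g A, R g A → ∀ τ : ℍ, f (g.mat • τ) = g.phi τ ^ (2 * k) • A.mulVec (f τ)

/-- `c(γ, n)` is supported on `n ∈ ℤ + q(γ)`. -/
def SuppCoset (q : D → ℚ) (c : D → ℚ → ℂ) : Prop :=
  ∀ γ n, c γ n ≠ 0 → ∃ j : ℤ, n = j + q γ

/-- `c(γ, n)` is supported on `n ≫ -∞`. -/
def SuppBddBelow (c : D → ℚ → ℂ) : Prop :=
  ∃ N : ℚ, ∀ γ n, c γ n ≠ 0 → N ≤ n

/-- `f(τ) = ∑_γ ∑_{n ∈ ℤ + q(γ), n ≫ -∞} c(γ, n) e(nτ) 𝔢_γ`. -/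
structure HasFourierExpansion (q : D → ℚ) (f : ℍ → D → ℂ) (c : D → ℚ → ℂ) : Prop where
  suppCoset : SuppCoset q c
  bddBelow : SuppBddBelow c
  hasSum : ∀ τ γ, HasSum (fun n : ℚ => c γ n * expTau n τ) (f τ γ)

/-- `f = f⁺ + f⁻` with
`f⁺(τ) = ∑_γ ∑_{n ∈ ℤ + q(γ), n ≫ -∞} c⁺(γ, n) e(nτ) 𝔢_γ` and
`f⁻(τ) = ∑_γ ∑_{n ∈ ℤ + q(γ), n < 0} c⁻(γ, n) Γ(1 - k, 4π|n|y) e(nτ) 𝔢_γ`. -/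
structure HasMaassExpansion (q : D → ℚ) (k : ℤ) (f : ℍ → D → ℂ) (cp cm : D → ℚ → ℂ) :
    Prop where
  suppCoset_pos : SuppCoset q cp
  bddBelow_pos : SuppBddBelow cp
  suppCoset_neg : SuppCoset q cm
  neg_of_ne_zero : ∀ γ n, cm γ n ≠ 0 → n < 0
  expansion : ∀ τ γ, ∃ a b : ℂ,
    HasSum (fun n : ℚ => cp γ n * expTau n τ) a ∧
    HasSum (fun n : ℚ =>
      cm γ n * (incGamma ((1 - k : ℤ) : ℝ) (4 * Real.pi * |(n : ℝ)| * τ.im) : ℂ) * expTau n τ) b ∧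
    f τ γ = a + b

/-- Weakly holomorphic modular forms of weight `k` and given type. -/
structure IsWeaklyHolomorphic (R : Mp2Z → Matrix D D ℂ → Prop) (q : D → ℚ) (k : ℤ)
    (f : ℍ → D → ℂ) : Prop where
  holo : ∀ γ, MDifferentiable 𝓘(ℂ) 𝓘(ℂ) (fun τ => f τ γ)
  modular : IsModular R k f
  meromorphic : ∃ c, HasFourierExpansion q f c

/-- Harmonic weak Maass forms of weight `k` and given type. In `growth`, `P` collects the
coefficients of the Fourier polynomial `P_f`, and the `O`-term is as `y → ∞`, uniformly in `x`. -/
structure IsHarmonicMaass (R : Mp2Z → Matrix D D ℂ → Prop) (q : D → ℚ) (k : ℤ)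
    (f : ℍ → D → ℂ) : Prop where
  smooth : ∀ γ, ContDiffOn ℝ ∞ ((fun τ => f τ γ) ∘ ofComplex) {z : ℂ | 0 < z.im}
  modular : IsModular R k f
  harmonic : ∀ γ τ, hypLaplacian k (fun z => f z γ) τ = 0
  growth : ∃ P : D → ℚ →₀ ℂ,
    (∀ γ n, P γ n ≠ 0 → (∃ j : ℤ, n = j + q γ) ∧ n ≤ 0) ∧
    ∃ ε : ℝ, 0 < ε ∧ ∀ γ,
      (fun τ : ℍ => f τ γ - (P γ).sum fun n a => a * expTau n τ)
        =O[atImInfty] fun τ : ℍ => Real.exp (-ε * τ.im)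

end VectorValued

namespace EvenLattice

variable {V : Type*} [AddCommGroup V] [Module ℚ V] (Λ : EvenLattice V)

/-- `H_{k, ρ_L}`. -/
def H (k : ℤ) : Set (ℍ → Λ.Disc → ℂ) := {f | IsHarmonicMaass Λ.WeilRel Λ.q k f}

/-- `H_{k, ρ̄_L}`. -/
def HDual (k : ℤ) : Set (ℍ → Λ.Disc → ℂ) :=
  {f | IsHarmonicMaass Λ.DualWeilRel (fun γ => -Λ.q γ) k f}

/-- `M^!_{k, ρ̄_L}`. -/
def MDual (k : ℤ) : Set (ℍ → Λ.Disc → ℂ) :=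
  {f | IsWeaklyHolomorphic Λ.DualWeilRel (fun γ => -Λ.q γ) k f}

end EvenLattice

end

noncomputable section

open scoped ComplexConjugate

/-! ### Wirtinger calculus on the upper half plane -/

/-! Put k = -n and g = D^{n+1}h with h harmonic of weight -n and dual type; write ∂ = ∂/∂τ, ∂̄ =
∂/∂τ̄, E = 1/(2iy), R_κ = ∂ + κE and Rⁿh = R_{n-2} ⋯ R_{-n}h. The proof rests on the 1-form ω = (∑
f_γ ∂^{n+1}h_γ) dτ + (∑ ∂̄f_γ · Rⁿh_γ) dτ̄.

Harmonicity means ∂∂̄f = nE ∂̄f, that is, ∂̄f is yⁿ times an antiholomorphic function, and likewise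
for h. Hence ∂^{n+1}∂̄h = 0, so ∂^{n+1}h is holomorphic. By Bol's identity
(`raiseIter_eq_iterate_dz`) R_n(Rⁿh) = ∂^{n+1}h, so ∂^{n+1}h is modular of weight n + 2. The same
two facts show that ω is closed, and it is SL₂(ℤ)-invariant because the types of f and h are dual.
Every homomorphism SL₂(ℤ) → ℂ vanishes, so a primitive of ω is invariant under τ ↦ τ + 1
(`primitive_periodic`), and the integral of ω over a horizontal segment of length 1 is zero
(`integral_pairing_eq_zero`). No truncated fundamental domain is needed.

By Parseval that integral is a sum over the modes ν of f paired with the modes -ν of h. Closedness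
holds mode by mode, so each contribution is independent of y, and y → ∞ identifies it, up to the
power of 2πi in D, with c_f⁺(ν) c_g(-ν) (`fcoeff_pairing`). Summing over γ and ν gives the theorem.

The expansions come from ordinary differential equations in y: the mode ν of ∂̄f is a multiple of
yⁿe^{2πνy}, and the growth condition kills it for ν ≥ 0, while for ν < 0 integration produces the
incomplete Gamma function (`exists_fcoeff_eq`). -/

theorem isOpen_im_pos : IsOpen {z : ℂ | 0 < z.im} := isOpen_lt continuous_const Complex.continuous_im

theorem convex_im_pos : Convex ℝ {z : ℂ | 0 < z.im} := convex_halfSpace_im_gt 0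

/-- Real smoothness of a function on the upper half plane. -/
def SmoothOnH (F : ℍ → ℂ) : Prop := ContDiffOn ℝ ∞ (F ∘ ofComplex) {z : ℂ | 0 < z.im}

/-- The real-linear map `v ↦ a v + b v̄`. -/
def wirtinger (a b : ℂ) : ℂ →L[ℝ] ℂ :=
  a • ContinuousLinearMap.id ℝ ℂ + b • (Complex.conjCLE : ℂ →L[ℝ] ℂ)

@[simp] theorem wirtinger_apply (a b v : ℂ) : wirtinger a b v = a * v + b * conj v := by
  simp [wirtinger]

/-- `F` is real differentiable at `τ` with `∂F/∂τ = a` and `∂F/∂τ̄ = b`. -/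
def HasWirtingerAt (F : ℍ → ℂ) (a b : ℂ) (τ : ℍ) : Prop :=
  HasFDerivAt (F ∘ ofComplex) (wirtinger a b) (τ : ℂ)

/-- `∂F/∂τ`. -/
def dz (F : ℍ → ℂ) : ℍ → ℂ := fun τ => (partialX F τ - Complex.I * partialY F τ) / 2

/-- `∂F/∂τ̄`. -/
def dzb (F : ℍ → ℂ) : ℍ → ℂ := fun τ => (partialX F τ + Complex.I * partialY F τ) / 2

theorem partialX_eq (F : ℍ → ℂ) (τ : ℍ) : partialX F τ = dz F τ + dzb F τ := by
  simp only [dz, dzb]; ring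

theorem partialY_eq (F : ℍ → ℂ) (τ : ℍ) : partialY F τ = Complex.I * (dz F τ - dzb F τ) := by
  simp only [dz, dzb]
  linear_combination partialY F τ * Complex.I_sq

theorem clm_eq_wirtinger (A : ℂ →L[ℝ] ℂ) :
    A = wirtinger ((A 1 - Complex.I * A Complex.I) / 2) ((A 1 + Complex.I * A Complex.I) / 2) := by
  ext v
  have h : A v = v.re * A 1 + v.im * A Complex.I := by
    conv_lhs => rw [← Complex.re_add_im v]
    rw [map_add, ← mul_one (v.re : ℂ), ← Complex.real_smul, ← Complex.real_smul, map_smul, map_smul]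
    simp
  have h1 : conj v = v.re - v.im * Complex.I := by
    apply Complex.ext <;> simp
  rw [wirtinger_apply, h, h1]
  conv_rhs => rw [← Complex.re_add_im v]
  simp only [Complex.add_re, Complex.ofReal_re, Complex.mul_re, Complex.I_re, Complex.ofReal_im,
    Complex.I_im, Complex.add_im, Complex.mul_im]
  push_cast
  linear_combination (v.im * A Complex.I) * Complex.I_sq

namespace HasWirtingerAt

variable {F G : ℍ → ℂ} {a b a' b' : ℂ} {τ : ℍ}

theorem dz_eq (h : HasWirtingerAt F a b τ) : dz F τ = a := by
  simp only [dz, partialX, partialY, HasFDerivAt.fderiv h, wirtinger_apply, map_one, Complex.conj_I]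
  linear_combination (-a / 2 + b / 2) * Complex.I_sq

theorem dzb_eq (h : HasWirtingerAt F a b τ) : dzb F τ = b := by
  simp only [dzb, partialX, partialY, HasFDerivAt.fderiv h, wirtinger_apply, map_one,
    Complex.conj_I]
  linear_combination (a / 2 - b / 2) * Complex.I_sq

theorem congr_coeff (h : HasWirtingerAt F a b τ) (ha : a = a') (hb : b = b') :
    HasWirtingerAt F a' b' τ := by rwa [← ha, ← hb]

theorem add (h : HasWirtingerAt F a b τ) (h' : HasWirtingerAt G a' b' τ) :
    HasWirtingerAt (fun z => F z + G z) (a + a') (b + b') τ := by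
  refine (HasFDerivAt.add h h').congr_fderiv ?_
  ext v; simp; ring

theorem const_mul (c : ℂ) (h : HasWirtingerAt F a b τ) :
    HasWirtingerAt (fun z => c * F z) (c * a) (c * b) τ := by
  refine (HasFDerivAt.const_mul h c).congr_fderiv ?_
  ext v; simp; ring

theorem mul (h : HasWirtingerAt F a b τ) (h' : HasWirtingerAt G a' b' τ) :
    HasWirtingerAt (fun z => F z * G z) (a * G τ + F τ * a') (b * G τ + F τ * b') τ := by
  refine (HasFDerivAt.mul h h').congr_fderiv ?_
  ext v; simp; ring

theorem sum {ι : Type*} {s : Finset ι} {F : ι → ℍ → ℂ} {a b : ι → ℂ}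
    (h : ∀ i ∈ s, HasWirtingerAt (F i) (a i) (b i) τ) :
    HasWirtingerAt (fun z => ∑ i ∈ s, F i z) (∑ i ∈ s, a i) (∑ i ∈ s, b i) τ := by
  have := HasFDerivAt.fun_sum h
  refine HasFDerivAt.congr_fderiv (f' := ∑ i ∈ s, wirtinger (a i) (b i)) this ?_
  ext v
  simp [Finset.sum_add_distrib, Finset.sum_mul]

end HasWirtingerAt

/-- A holomorphic function of the coordinate. -/
theorem hasWirtingerAt_of_hasDerivAt {f : ℂ → ℂ} {f' : ℂ} {τ : ℍ} (h : HasDerivAt f f' (τ : ℂ)) :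
    HasWirtingerAt (fun z : ℍ => f z) f' 0 τ := by
  have h1 : HasFDerivAt f (wirtinger f' 0) (τ : ℂ) := by
    refine (h.hasFDerivAt.restrictScalars ℝ).congr_fderiv ?_
    ext v; simp [mul_comm]
  refine HasFDerivAt.congr_of_eventuallyEq h1 ?_
  filter_upwards [isOpen_im_pos.mem_nhds τ.im_pos] with z hz
  simp [ofComplex_apply_of_im_pos hz]

theorem hasWirtingerAt_const (c : ℂ) (τ : ℍ) : HasWirtingerAt (fun _ => c) 0 0 τ :=
  hasWirtingerAt_of_hasDerivAt (hasDerivAt_const _ c)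

/-! ### Smooth functions on ℍ: closure properties and symmetry of second derivatives. -/

namespace SmoothOnH

variable {F G : ℍ → ℂ}

theorem hasWirtingerAt (h : SmoothOnH F) (τ : ℍ) : HasWirtingerAt F (dz F τ) (dzb F τ) τ := by
  have h1 := ((h.contDiffAt (isOpen_im_pos.mem_nhds τ.im_pos)).differentiableAt
    (by simp)).hasFDerivAt
  rw [clm_eq_wirtinger (fderiv ℝ (F ∘ ofComplex) τ)] at h1
  exact h1

theorem add (h : SmoothOnH F) (h' : SmoothOnH G) : SmoothOnH fun z => F z + G z :=
  ContDiffOn.add h h'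

theorem mul (h : SmoothOnH F) (h' : SmoothOnH G) : SmoothOnH fun z => F z * G z :=
  ContDiffOn.mul h h'

theorem const (c : ℂ) : SmoothOnH fun _ => c := contDiffOn_const

theorem const_mul (c : ℂ) (h : SmoothOnH F) : SmoothOnH fun z => c * F z := (const c).mul h

theorem sum {ι : Type*} {s : Finset ι} {F : ι → ℍ → ℂ} (h : ∀ i ∈ s, SmoothOnH (F i)) :
    SmoothOnH fun z => ∑ i ∈ s, F i z :=
  ContDiffOn.sum h

theorem of_contDiffOn {f : ℂ → ℂ} (h : ContDiffOn ℝ ∞ f {z : ℂ | 0 < z.im}) :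
    SmoothOnH fun z : ℍ => f z :=
  h.congr fun z hz => by simp [ofComplex_apply_of_im_pos hz]

theorem fderiv_apply (h : SmoothOnH F) (v : ℂ) :
    SmoothOnH fun τ : ℍ => fderiv ℝ (F ∘ ofComplex) (τ : ℂ) v :=
  of_contDiffOn (f := fun z => fderiv ℝ (F ∘ ofComplex) z v)
    ((ContDiffOn.fderiv_of_isOpen h isOpen_im_pos (m := ∞) (by simp)).clm_apply contDiffOn_const)

theorem partialX (h : SmoothOnH F) : SmoothOnH (partialX F) := h.fderiv_apply 1

theorem partialY (h : SmoothOnH F) : SmoothOnH (partialY F) := h.fderiv_apply Complex.I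

theorem dz (h : SmoothOnH F) : SmoothOnH (dz F) := by
  convert (h.partialX.add (h.partialY.const_mul (-Complex.I))).const_mul (1 / 2) using 1
  funext z; simp only [_root_.dz]; ring

theorem dzb (h : SmoothOnH F) : SmoothOnH (dzb F) := by
  convert (h.partialX.add (h.partialY.const_mul Complex.I)).const_mul (1 / 2) using 1
  funext z; simp only [_root_.dzb]; ring

theorem iterate_dz (h : SmoothOnH F) (n : ℕ) : SmoothOnH (_root_.dz^[n] F) := by
  induction n with
  | zero => exact h
  | succ n ih => rw [Function.iterate_succ_apply']; exact ih.dz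

theorem continuousOn (h : SmoothOnH F) : ContinuousOn (F ∘ ofComplex) {z : ℂ | 0 < z.im} :=
  ContDiffOn.continuousOn h

theorem fderiv_fderiv_apply (h : SmoothOnH F) (v w : ℂ) (τ : ℍ) :
    fderiv ℝ ((fun τ : ℍ => fderiv ℝ (F ∘ ofComplex) (τ : ℂ) v) ∘ ofComplex) (τ : ℂ) w =
      fderiv ℝ (fderiv ℝ (F ∘ ofComplex)) (τ : ℂ) w v := by
  have h1 : ((fun τ : ℍ => fderiv ℝ (F ∘ ofComplex) (τ : ℂ) v) ∘ ofComplex) =ᶠ[nhds (τ : ℂ)]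
      fun z => fderiv ℝ (F ∘ ofComplex) z v := by
    filter_upwards [isOpen_im_pos.mem_nhds τ.im_pos] with z hz
    simp [ofComplex_apply_of_im_pos hz]
  have h2 : DifferentiableAt ℝ (fderiv ℝ (F ∘ ofComplex)) (τ : ℂ) :=
    ((ContDiffOn.fderiv_of_isOpen h isOpen_im_pos (m := ∞) (by simp)).contDiffAt
      (isOpen_im_pos.mem_nhds τ.im_pos)).differentiableAt (by simp)
  rw [h1.fderiv_eq, (h2.hasFDerivAt.clm_apply (hasFDerivAt_const v _)).fderiv]
  simp

theorem partialX_partialY (h : SmoothOnH F) (τ : ℍ) :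
    _root_.partialX (_root_.partialY F) τ = _root_.partialY (_root_.partialX F) τ := by
  have hs : IsSymmSndFDerivAt ℝ (F ∘ ofComplex) (τ : ℂ) :=
    ((h.contDiffAt (isOpen_im_pos.mem_nhds τ.im_pos))).isSymmSndFDerivAt
      (by simp; exact WithTop.coe_le_coe.2 le_top)
  change fderiv ℝ ((fun τ : ℍ => fderiv ℝ (F ∘ ofComplex) (τ : ℂ) Complex.I) ∘ ofComplex) τ 1 =
    fderiv ℝ ((fun τ : ℍ => fderiv ℝ (F ∘ ofComplex) (τ : ℂ) 1) ∘ ofComplex) τ Complex.I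
  rw [h.fderiv_fderiv_apply, h.fderiv_fderiv_apply]
  exact hs.eq _ _

end SmoothOnH

/-! ### Global rules for ∂ and ∂̄, and the Laplacian. -/

section Rules

variable {F G : ℍ → ℂ}

theorem dz_mul (hF : SmoothOnH F) (hG : SmoothOnH G) (τ : ℍ) :
    dz (fun z => F z * G z) τ = dz F τ * G τ + F τ * dz G τ :=
  ((hF.hasWirtingerAt τ).mul (hG.hasWirtingerAt τ)).dz_eq

theorem dz_add (hF : SmoothOnH F) (hG : SmoothOnH G) (τ : ℍ) :
    dz (fun z => F z + G z) τ = dz F τ + dz G τ :=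
  ((hF.hasWirtingerAt τ).add (hG.hasWirtingerAt τ)).dz_eq

theorem dz_const_mul (c : ℂ) (hF : SmoothOnH F) (τ : ℍ) :
    dz (fun z => c * F z) τ = c * dz F τ :=
  ((hF.hasWirtingerAt τ).const_mul c).dz_eq

theorem dzb_const_mul (c : ℂ) (hF : SmoothOnH F) (τ : ℍ) :
    dzb (fun z => c * F z) τ = c * dzb F τ :=
  ((hF.hasWirtingerAt τ).const_mul c).dzb_eq

/-- Expanding ∂∂̄ in x and y, the mixed second derivatives cancel by symmetry. -/
theorem partial_dz_dzb (hF : SmoothOnH F) (τ : ℍ) :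
    partialX (partialX F) τ + partialY (partialY F) τ = 4 * dz (dzb F) τ := by
  have hX := hF.partialX.hasWirtingerAt τ
  have hY := hF.partialY.hasWirtingerAt τ
  have h : dzb F = fun z => 1 / 2 * partialX F z + Complex.I / 2 * partialY F z := by
    funext z; simp only [dzb]; ring
  have h1 := ((hX.const_mul (1 / 2)).add (hY.const_mul (Complex.I / 2))).dz_eq
  rw [h, h1]
  have := hF.partialX_partialY τ
  simp only [dz]
  linear_combination partialY (partialY F) τ * Complex.I_sq - Complex.I * this

theorem dzb_dz (hF : SmoothOnH F) (τ : ℍ) : dzb (dz F) τ = dz (dzb F) τ := by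
  have hX := hF.partialX.hasWirtingerAt τ
  have hY := hF.partialY.hasWirtingerAt τ
  have h : dzb F = fun z => 1 / 2 * partialX F z + Complex.I / 2 * partialY F z := by
    funext z; simp only [dzb]; ring
  have h' : dz F = fun z => 1 / 2 * partialX F z + (-Complex.I / 2) * partialY F z := by
    funext z; simp only [dz]; ring
  have h1 := ((hX.const_mul (1 / 2)).add (hY.const_mul (Complex.I / 2))).dz_eq
  have h2 := ((hX.const_mul (1 / 2)).add (hY.const_mul (-Complex.I / 2))).dzb_eq
  rw [h, h', h1, h2]
  have := hF.partialX_partialY τ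
  simp only [dz, dzb]
  linear_combination (-Complex.I / 2) * this

theorem dzb_iterate_dz (hF : SmoothOnH F) (n : ℕ) : dzb (dz^[n] F) = dz^[n] (dzb F) := by
  induction n with
  | zero => rfl
  | succ n ih =>
    rw [Function.iterate_succ_apply', Function.iterate_succ_apply', ← ih]
    exact funext (dzb_dz (hF.iterate_dz n))

/-- A smooth function killed by `∂/∂τ̄` is holomorphic. -/
theorem mdifferentiable_of_dzb_eq_zero (hF : SmoothOnH F) (h : ∀ τ, dzb F τ = 0) :
    MDifferentiable 𝓘(ℂ) 𝓘(ℂ) F := by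
  rw [mdifferentiable_iff]
  intro z hz
  have h1 := hF.hasWirtingerAt ⟨z, hz⟩
  -- With ∂̄F = 0 the real derivative is multiplication by ∂F, so the real and the complex little-o
  -- conditions coincide.
  rw [h, HasWirtingerAt, hasFDerivAt_iff_isLittleO] at h1
  refine (HasDerivAt.differentiableAt (f' := dz F ⟨z, hz⟩) ?_).differentiableWithinAt
  rw [hasDerivAt_iff_isLittleO]
  refine h1.congr_left fun w => ?_
  simp [mul_comm]

end Rules

/-! ### The function `1 / (2iy)` -/

/-- `E(τ) = 1 / (2iy)`. -/
def invTwoIY : ℍ → ℂ := fun τ => 1 / (2 * Complex.I * τ.im)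

/-- `2iy = τ - τ̄`. -/
def twoIY : ℍ → ℂ := fun τ => 2 * Complex.I * τ.im

theorem twoIY_mul_invTwoIY (τ : ℍ) : twoIY τ * invTwoIY τ = 1 := by
  have : (τ.im : ℂ) ≠ 0 := by exact_mod_cast τ.im_pos.ne'
  simp only [twoIY, invTwoIY]
  field_simp

theorem hasWirtingerAt_twoIY (τ : ℍ) : HasWirtingerAt twoIY 1 (-1) τ := by
  have h1 : HasFDerivAt (fun z : ℂ => z - conj z) (wirtinger 1 (-1)) (τ : ℂ) := by
    refine ((hasFDerivAt_id (τ : ℂ)).sub (Complex.conjCLE.hasFDerivAt)).congr_fderiv ?_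
    ext v; simp; ring
  refine HasFDerivAt.congr_of_eventuallyEq h1 ?_
  filter_upwards [isOpen_im_pos.mem_nhds τ.im_pos] with z hz
  rw [Complex.sub_conj]
  simp only [twoIY, Function.comp_apply, ofComplex_apply_of_im_pos hz]
  push_cast
  change _ * (z.im : ℂ) = _
  ring

theorem SmoothOnH.twoIY : SmoothOnH twoIY := by
  have : ContDiffOn ℝ ∞ (fun z : ℂ => z - conj z) {z : ℂ | 0 < z.im} :=
    (contDiff_id.sub Complex.conjCLE.contDiff).contDiffOn
  refine this.congr fun z hz => ?_
  have hz' : 0 < z.im := hz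
  simp only [_root_.twoIY, Function.comp_apply, ofComplex_apply_of_im_pos hz']
  rw [Complex.sub_conj]
  push_cast
  change _ * (z.im : ℂ) = _
  ring

theorem SmoothOnH.invTwoIY : SmoothOnH invTwoIY := by
  have h := SmoothOnH.twoIY
  refine (ContDiffOn.inv h fun z hz => ?_).congr fun z hz => ?_
  · exact left_ne_zero_of_mul_eq_one (twoIY_mul_invTwoIY _)
  · exact (inv_eq_of_mul_eq_one_right (twoIY_mul_invTwoIY _)).symm

/-- Differentiate 2iy · E = 1, using ∂(2iy) = 1 and ∂̄(2iy) = -1. -/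
theorem hasWirtingerAt_invTwoIY (τ : ℍ) :
    HasWirtingerAt invTwoIY (-invTwoIY τ ^ 2) (invTwoIY τ ^ 2) τ := by
  have h := SmoothOnH.invTwoIY.hasWirtingerAt τ
  have h1 := (hasWirtingerAt_twoIY τ).mul h
  have h2 : (fun z => twoIY z * invTwoIY z) = fun _ => 1 := funext twoIY_mul_invTwoIY
  rw [h2] at h1
  have ha := h1.dz_eq.symm.trans (hasWirtingerAt_const 1 τ).dz_eq
  have hb := h1.dzb_eq.symm.trans (hasWirtingerAt_const 1 τ).dzb_eq
  have hE := twoIY_mul_invTwoIY τ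
  refine h.congr_coeff ?_ ?_
  · linear_combination invTwoIY τ * ha - dz invTwoIY τ * hE
  · linear_combination invTwoIY τ * hb - dzb invTwoIY τ * hE

end

noncomputable section

open scoped ComplexConjugate

/-! ### Harmonic functions -/

theorem SmoothOnH.pow {F : ℍ → ℂ} (h : SmoothOnH F) (j : ℕ) : SmoothOnH fun z => F z ^ j :=
  ContDiffOn.pow h j

/-- Since Δ_k = -4y²∂∂̄ + 2iky∂̄, harmonicity is a first-order equation for ∂̄F; it says that y^k
∂̄F is antiholomorphic. All later arguments use harmonicity in this form only. -/
theorem dz_dzb_of_hypLaplacian_eq_zero {k : ℤ} {F : ℍ → ℂ} (hF : SmoothOnH F)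
    (h : ∀ τ, hypLaplacian k F τ = 0) (τ : ℍ) :
    dz (dzb F) τ = -k * invTwoIY τ * dzb F τ := by
  have h1 := h τ
  have hy : (τ.im : ℂ) ≠ 0 := by exact_mod_cast τ.im_pos.ne'
  have h2 : partialX F τ + Complex.I * partialY F τ = 2 * dzb F τ := by simp only [dzb]; ring
  rw [hypLaplacian, partial_dz_dzb hF, h2] at h1
  have h3 : (2 * τ.im : ℂ) * dz (dzb F) τ = Complex.I * k * dzb F τ := by
    apply mul_left_cancel₀ hy
    linear_combination (-1 / 2 : ℂ) * h1
  have h4 : (2 * τ.im : ℂ) * invTwoIY τ = -Complex.I := by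
    simp only [invTwoIY]; field_simp; simp
  apply mul_left_cancel₀ (mul_ne_zero two_ne_zero hy)
  linear_combination h3 + k * dzb F τ * h4

/-- As ∂E = -E², one has ∂(E^j u) = (n - j)E^{j+1}u, so repeated differentiation builds up a falling
factorial. -/
theorem iterate_dz_of_dz_eq {n : ℕ} {u : ℍ → ℂ} (hu : SmoothOnH u)
    (h : ∀ τ, dz u τ = n * invTwoIY τ * u τ) (j : ℕ) :
    dz^[j] u = fun τ => (n.descFactorial j : ℂ) * (invTwoIY τ ^ j * u τ) := by
  induction j with
  | zero => funext τ; simp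
  | succ j ih =>
    rw [Function.iterate_succ_apply', ih]
    funext τ
    have hE : SmoothOnH fun z => invTwoIY z ^ j := SmoothOnH.invTwoIY.pow j
    have hEd : dz (fun z => invTwoIY z ^ j) τ = -(j : ℂ) * invTwoIY τ ^ (j + 1) := by
      clear ih hE
      induction j with
      | zero => simpa using (hasWirtingerAt_const 1 τ).dz_eq
      | succ j ih =>
        simp only [pow_succ _ j]
        rw [dz_mul (SmoothOnH.invTwoIY.pow j) SmoothOnH.invTwoIY, ih,
          (hasWirtingerAt_invTwoIY τ).dz_eq]
        push_cast; ring
    rw [dz_const_mul _ (hE.mul hu), dz_mul hE hu, h, hEd, Nat.descFactorial_succ]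
    -- Natural subtraction n - j truncates for j > n, but there the factor `n.descFactorial j` is
    -- already zero.
    rcases le_or_gt j n with hj | hj
    · push_cast [Nat.cast_sub hj]; ring
    · rw [Nat.descFactorial_of_lt hj]; simp

/-- Here u is yⁿ times an antiholomorphic function, and ∂^{n+1} kills yⁿ. Applied to u = ∂̄h, this
gives the holomorphy of ∂^{n+1}h. -/
theorem iterate_dz_eq_zero {n : ℕ} {u : ℍ → ℂ} (hu : SmoothOnH u)
    (h : ∀ τ, dz u τ = n * invTwoIY τ * u τ) : dz^[n + 1] u = fun _ => 0 := by
  rw [iterate_dz_of_dz_eq hu h, Nat.descFactorial_of_lt (Nat.lt_succ_self n)]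
  simp

/-! ### Raising operators and Bol's identity -/

/-- The raising operator `R_κ = ∂/∂τ + κ / (2iy)`. -/
def raise (κ : ℂ) (F : ℍ → ℂ) : ℍ → ℂ := fun τ => dz F τ + κ * invTwoIY τ * F τ

/-- The iterated raising operator `R_{κ + 2n - 2} ⋯ R_{κ + 2} R_κ`. -/
def raiseIter (κ : ℂ) : ℕ → (ℍ → ℂ) → ℍ → ℂ
  | 0, F => F
  | n + 1, F => raise (κ + 2 * n) (raiseIter κ n F)

theorem SmoothOnH.raise {F : ℍ → ℂ} (hF : SmoothOnH F) (κ : ℂ) : SmoothOnH (raise κ F) :=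
  hF.dz.add ((SmoothOnH.invTwoIY.const_mul κ).mul hF)

theorem SmoothOnH.raiseIter {F : ℍ → ℂ} (hF : SmoothOnH F) (κ : ℂ) (n : ℕ) :
    SmoothOnH (raiseIter κ n F) := by
  induction n with
  | zero => exact hF
  | succ n ih => exact ih.raise _

/-- Because ∂E = -E², a factor E passes through a raising operator at the cost of lowering κ by one.
This shift drives the induction in Bol's identity. -/
theorem raise_invTwoIY_mul {F : ℍ → ℂ} (hF : SmoothOnH F) (κ : ℂ) :
    raise κ (fun z => invTwoIY z * F z) = fun z => invTwoIY z * raise (κ - 1) F z := by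
  funext τ
  simp only [raise]
  rw [dz_mul SmoothOnH.invTwoIY hF, (hasWirtingerAt_invTwoIY τ).dz_eq]
  ring

theorem raiseIter_invTwoIY_mul {F : ℍ → ℂ} (hF : SmoothOnH F) (κ : ℂ) (n : ℕ) :
    raiseIter κ n (fun z => invTwoIY z * F z) =
      fun z => invTwoIY z * raiseIter (κ - 1) n F z := by
  induction n with
  | zero => rfl
  | succ n ih =>
    rw [raiseIter, ih, raise_invTwoIY_mul (hF.raiseIter _ n)]
    simp only [raiseIter]
    rw [show κ + 2 * (n : ℂ) - 1 = κ - 1 + 2 * n by ring]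

/-- Leibniz' rule; only two terms survive because ∂(2iy) = 1 is constant. -/
theorem iterate_dz_twoIY_mul {G : ℍ → ℂ} (hG : SmoothOnH G) (n : ℕ) :
    dz^[n + 1] (fun z => twoIY z * G z) =
      fun z => twoIY z * dz^[n + 1] G z + (n + 1) * dz^[n] G z := by
  induction n with
  | zero =>
    funext τ
    simp only [zero_add, Function.iterate_one, Function.iterate_zero, id]
    rw [dz_mul SmoothOnH.twoIY hG, (hasWirtingerAt_twoIY τ).dz_eq]
    push_cast; ring
  | succ n ih =>
    rw [Function.iterate_succ_apply', ih]
    funext τ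
    have h1 := hG.iterate_dz (n + 1)
    have h0 := hG.iterate_dz n
    rw [dz_add (SmoothOnH.twoIY.mul h1) (h0.const_mul _), dz_mul SmoothOnH.twoIY h1,
      dz_const_mul _ h0, (hasWirtingerAt_twoIY τ).dz_eq, ← Function.iterate_succ_apply' dz,
      ← Function.iterate_succ_apply' dz]
    push_cast; ring

/-- Bol's identity. -/
theorem raiseIter_eq_iterate_dz {F : ℍ → ℂ} (hF : SmoothOnH F) (n : ℕ) :
    raiseIter (1 - n) n F = dz^[n] F := by
  induction n generalizing F with
  | zero => rfl
  | succ n ih =>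
    -- Write F = 2iy · K. Passing to K turns the starting weight -n into 1 - n, to which the
    -- induction hypothesis applies. The last operator R_n then maps 2iy ∂ⁿK to 2iy ∂^{n+1}K + (n +
    -- 1)∂ⁿK, which is ∂^{n+1}(2iy K).
    have hK : SmoothOnH fun z => invTwoIY z * F z := SmoothOnH.invTwoIY.mul hF
    have h1 : raiseIter (1 - (n + 1 : ℕ)) n F =
        fun z => twoIY z * dz^[n] (fun z => invTwoIY z * F z) z := by
      rw [← ih hK, raiseIter_invTwoIY_mul hF]
      funext z
      rw [← mul_assoc, twoIY_mul_invTwoIY, one_mul, Nat.cast_succ, sub_add_eq_sub_sub]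
    have h2 : F = fun z => twoIY z * (invTwoIY z * F z) := by
      funext z; rw [← mul_assoc, twoIY_mul_invTwoIY, one_mul]
    conv_rhs => rw [h2, iterate_dz_twoIY_mul hK]
    rw [raiseIter, h1]
    funext τ
    have hKn := hK.iterate_dz n
    simp only [raise]
    rw [dz_mul SmoothOnH.twoIY hKn, (hasWirtingerAt_twoIY τ).dz_eq,
      ← Function.iterate_succ_apply' dz]
    have := twoIY_mul_invTwoIY τ
    push_cast
    linear_combination (n : ℂ) * dz^[n] (fun z => invTwoIY z * F z) τ * this

/-! ### Transformation behaviour -/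

/-- Chain rule for a holomorphic map with derivative (cτ + d)^{-2}; its conjugate enters only in ∂̄.
-/
theorem HasWirtingerAt.comp_smul {F : ℍ → ℂ} {a b : ℂ} (M : SL(2, ℤ)) {τ : ℍ}
    (h : HasWirtingerAt F a b (M • τ)) :
    HasWirtingerAt (fun z => F (M • z)) (a / denom M τ ^ 2) (b / conj (denom M τ) ^ 2) τ := by
  have h1 : HasDerivAt (fun z : ℂ => ((M • ofComplex z : ℍ) : ℂ)) (1 / denom M τ ^ 2) τ := by
    have hdet : (M : GL (Fin 2) ℝ).val.det = 1 := by
      rw [← Matrix.GeneralLinearGroup.val_det_apply]; simp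
    have := (hasStrictDerivAt_smul (g := (M : GL (Fin 2) ℝ)) (by rw [hdet]; exact one_pos)
      τ).hasDerivAt
    rw [hdet, Complex.ofReal_one] at this
    exact this
  have h2 : HasFDerivAt (F ∘ ofComplex) (wirtinger a b) ((M • ofComplex (τ : ℂ) : ℍ) : ℂ) := by
    rw [ofComplex_apply]; exact h
  have h3 := h2.comp (τ : ℂ) (h1.hasFDerivAt.restrictScalars ℝ)
  refine HasFDerivAt.congr_fderiv (f := (fun z => F (M • z)) ∘ ofComplex)
    (h3.congr_of_eventuallyEq ?_) ?_
  · exact Filter.Eventually.of_forall fun z => by simp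
  · ext v; simp; ring

theorem hasWirtingerAt_denom_zpow (M : SL(2, ℤ)) (k : ℤ) (τ : ℍ) :
    HasWirtingerAt (fun z : ℍ => denom M z ^ k) (k * (M 1 0 : ℂ) * denom M τ ^ (k - 1)) 0 τ := by
  refine hasWirtingerAt_of_hasDerivAt (f := fun z => denom M z ^ k) ?_
  have := hasDerivAt_denom_zpow (M : GL (Fin 2) ℝ) k τ
  simpa using! this

theorem invTwoIY_smul (M : SL(2, ℤ)) (τ : ℍ) :
    invTwoIY (M • τ) = denom M τ * conj (denom M τ) * invTwoIY τ := by
  have hd : denom M τ ≠ 0 := denom_ne_zero _ τ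
  simp only [invTwoIY, ModularGroup.im_smul_eq_div_normSq]
  rw [Complex.mul_conj]
  push_cast
  field_simp

/-- This is (cτ + d) - (cτ̄ + d) = c · 2iy divided by 2iy. It is what absorbs the derivative of the
automorphy factor in `TransformsBy.raise_apply`. -/
theorem denom_mul_conj_invTwoIY (M : SL(2, ℤ)) (τ : ℍ) :
    (M 1 0 : ℂ) + conj (denom M τ) * invTwoIY τ = denom M τ * invTwoIY τ := by
  have h1 : denom M τ - conj (denom M τ) = M 1 0 * twoIY τ := by
    rw [ModularGroup.denom_apply, twoIY]
    simp only [map_add, map_mul, map_intCast]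
    have := Complex.sub_conj (τ : ℂ)
    push_cast at this
    change _ = _ * (2 * Complex.I * ((τ : ℂ).im : ℂ))
    linear_combination (M 1 0 : ℂ) * this
  have := twoIY_mul_invTwoIY τ
  linear_combination -(M 1 0 : ℂ) * this - invTwoIY τ * h1

/-! ### Weights of ∂̄H and of the raised forms. -/

section Vector

variable {D : Type*} [Fintype D]

/-- `H(Mτ) = (cτ + d)^k A H(τ)`. -/
def TransformsBy (M : SL(2, ℤ)) (A : Matrix D D ℂ) (k : ℤ) (H : ℍ → D → ℂ) : Prop :=
  ∀ τ γ, H (M • τ) γ = denom M τ ^ k * A.mulVec (H τ) γ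

variable {M : SL(2, ℤ)} {A : Matrix D D ℂ} {k : ℤ} {H : ℍ → D → ℂ}

theorem TransformsBy.hasWirtingerAt (h : TransformsBy M A k H)
    (hH : ∀ γ, SmoothOnH fun z => H z γ) (τ : ℍ) (γ : D) :
    HasWirtingerAt (fun z => H (M • z) γ)
      (k * (M 1 0 : ℂ) * denom M τ ^ (k - 1) * A.mulVec (H τ) γ +
        denom M τ ^ k * A.mulVec (fun δ => dz (fun z => H z δ) τ) γ)
      (denom M τ ^ k * A.mulVec (fun δ => dzb (fun z => H z δ) τ) γ) τ := by
  have h1 : (fun z => H (M • z) γ) = fun z : ℍ => denom M z ^ k * ∑ δ, A γ δ * H z δ :=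
    funext fun z => h z γ
  rw [h1]
  refine ((hasWirtingerAt_denom_zpow M k τ).mul (HasWirtingerAt.sum fun δ _ =>
    ((hH δ).hasWirtingerAt τ).const_mul (A γ δ))).congr_coeff ?_ ?_
  · rfl
  · rw [zero_mul, zero_add]; rfl

/-- The automorphy factor is holomorphic, so ∂̄ sees only the conjugate derivative of the Möbius
map. -/
theorem TransformsBy.dzb_apply (h : TransformsBy M A k H) (hH : ∀ γ, SmoothOnH fun z => H z γ)
    (τ : ℍ) (γ : D) : dzb (fun z => H z γ) (M • τ) =
      denom M τ ^ k * conj (denom M τ) ^ 2 * A.mulVec (fun δ => dzb (fun z => H z δ) τ) γ := by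
  have hd : conj (denom M τ) ≠ 0 := by simp [denom_ne_zero]
  have h1 := (h.hasWirtingerAt hH τ γ).dzb_eq
  rw [(HasWirtingerAt.comp_smul M ((hH γ).hasWirtingerAt (M • τ))).dzb_eq,
    div_eq_iff (pow_ne_zero _ hd)] at h1
  rw [h1]; ring

/-- Differentiating (cτ + d)^k leaves the extra term kc(cτ + d)^{k-1}; the correction kE in the
raising operator cancels it. -/
theorem TransformsBy.raise_apply (h : TransformsBy M A k H) (hH : ∀ γ, SmoothOnH fun z => H z γ) :
    TransformsBy M A (k + 2) fun τ γ => raise k (fun z => H z γ) τ := by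
  intro τ γ
  have hd : denom M τ ≠ 0 := denom_ne_zero _ τ
  have h1 := (h.hasWirtingerAt hH τ γ).dz_eq
  rw [(HasWirtingerAt.comp_smul M ((hH γ).hasWirtingerAt (M • τ))).dz_eq,
    div_eq_iff (pow_ne_zero _ hd)] at h1
  have h2 : A.mulVec (fun δ => raise k (fun z => H z δ) τ) γ =
      A.mulVec (fun δ => dz (fun z => H z δ) τ) γ + k * invTwoIY τ * A.mulVec (H τ) γ := by
    simp only [raise, Matrix.mulVec, dotProduct, Finset.mul_sum]
    rw [← Finset.sum_add_distrib]
    exact Finset.sum_congr rfl fun δ _ => by ring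
  have h3 : denom M τ ^ k = denom M τ ^ (k - 1) * denom M τ := by
    rw [← zpow_add_one₀ hd, sub_add_cancel]
  have h4 := denom_mul_conj_invTwoIY M τ
  rw [h2]
  simp only [raise]
  rw [h1, h τ γ, invTwoIY_smul, zpow_add₀ hd, h3, zpow_ofNat]
  linear_combination k * A.mulVec (H τ) γ * denom M τ ^ (k - 1) * denom M τ ^ 2 * h4

theorem TransformsBy.raiseIter_apply (h : TransformsBy M A k H) (hH : ∀ γ, SmoothOnH fun z => H z γ)
    (n : ℕ) : TransformsBy M A (k + 2 * n) fun τ γ => raiseIter k n (fun z => H z γ) τ := by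
  induction n with
  | zero => simpa [raiseIter] using h
  | succ n ih =>
    have := ih.raise_apply fun γ => (hH γ).raiseIter k n
    simp only [raiseIter]
    push_cast at this ⊢
    rwa [show k + 2 * ((n : ℤ) + 1) = k + 2 * n + 2 by ring]

theorem TransformsBy.const_mul (h : TransformsBy M A k H) (c : ℂ) :
    TransformsBy M A k fun τ γ => c * H τ γ := by
  intro τ γ
  simp only [h τ γ, Matrix.mulVec, dotProduct, Finset.mul_sum]
  exact Finset.sum_congr rfl fun δ _ => by ring

/-- As k is an integer, φ^{2k} = (cτ + d)^k, so the metaplectic cover is felt only through the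
matrix A. -/
theorem isModular_iff {R : Mp2Z → Matrix D D ℂ → Prop} :
    IsModular R k H ↔ ∀ g A, R g A → TransformsBy g.mat A k H := by
  refine forall₃_congr fun g A _ => forall_congr' fun τ => ?_
  rw [zpow_mul, show g.phi τ ^ (2 : ℤ) = denom g.mat τ from g.sq τ, funext_iff]
  rfl

end Vector

end

noncomputable section

open scoped ComplexConjugate

/-! ### Invariant closed 1-forms on the upper half plane -/

/-- Poincaré's lemma on the convex set ℍ: the hypothesis says that P dτ + B dτ̄ is closed. -/
theorem exists_primitive {P B : ℍ → ℂ} (hP : SmoothOnH P) (hB : SmoothOnH B)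
    (h : ∀ τ, dzb P τ = dz B τ) : ∃ Φ : ℍ → ℂ, ∀ τ, HasWirtingerAt Φ (P τ) (B τ) τ := by
  let form : ℂ → ℂ →L[ℝ] ℂ := fun z => wirtinger ((P ∘ ofComplex) z) ((B ∘ ofComplex) z)
  have hform : ∀ τ : ℍ, HasFDerivAt form
      ((wirtinger (dz P τ) (dzb P τ)).smulRight (ContinuousLinearMap.id ℝ ℂ) +
        (wirtinger (dz B τ) (dzb B τ)).smulRight (Complex.conjCLE : ℂ →L[ℝ] ℂ)) (τ : ℂ) :=
    fun τ => (HasFDerivAt.smul_const (hP.hasWirtingerAt τ) _).add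
      (HasFDerivAt.smul_const (hB.hasWirtingerAt τ) (Complex.conjCLE : ℂ →L[ℝ] ℂ))
  obtain ⟨Φ, hΦ⟩ := convex_im_pos.exists_forall_hasFDerivAt_of_fderiv_symmetric isOpen_im_pos
    (show DifferentiableOn ℝ form _ from
      fun z hz => (hform ⟨z, hz⟩).differentiableAt.differentiableWithinAt) (fun z hz v w => by
      have := (hform ⟨z, hz⟩).fderiv
      change fderiv ℝ form z = _ at this
      rw [this]
      simp only [add_apply, ContinuousLinearMap.smulRight_apply,
        wirtinger_apply, h]
      simp
      ring)
  refine ⟨fun τ => Φ τ, fun τ => ?_⟩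
  have h1 := hΦ τ τ.im_pos
  simp only [form, Function.comp_apply, ofComplex_apply] at h1
  refine HasFDerivAt.congr_of_eventuallyEq h1 ?_
  filter_upwards [isOpen_im_pos.mem_nhds τ.im_pos] with z hz
  simp [ofComplex_apply_of_im_pos hz]

theorem eq_of_hasWirtingerAt_zero {F : ℍ → ℂ} (h : ∀ τ, HasWirtingerAt F 0 0 τ) (τ τ' : ℍ) :
    F τ = F τ' := by
  have h0 : wirtinger 0 0 = 0 := by ext; simp
  have := isOpen_im_pos.is_const_of_fderiv_eq_zero (𝕜 := ℝ) convex_im_pos.isPreconnected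
    (f := F ∘ ofComplex)
    (fun z hz => (HasFDerivAt.differentiableAt (h ⟨z, hz⟩)).differentiableWithinAt)
    (fun z hz => (HasFDerivAt.fderiv (h ⟨z, hz⟩)).trans h0) τ.im_pos τ'.im_pos
  simpa using this

/-- A primitive of an `SL₂(ℤ)`-invariant 1-form is periodic, as the abelianization of `SL₂(ℤ)` is
finite. -/
theorem primitive_periodic {P B Φ : ℍ → ℂ} (hΦ : ∀ τ, HasWirtingerAt Φ (P τ) (B τ) τ)
    (hP : ∀ (M : SL(2, ℤ)) τ, P (M • τ) = denom M τ ^ 2 * P τ)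
    (hB : ∀ (M : SL(2, ℤ)) τ, B (M • τ) = conj (denom M τ) ^ 2 * B τ) (τ : ℍ) :
    Φ (ModularGroup.T • τ) = Φ τ := by
  -- By invariance of the form, Φ ∘ M and Φ have the same differential, hence differ by a constant.
  have hc : ∀ M : SL(2, ℤ), ∃ c, ∀ τ, Φ (M • τ) = Φ τ + c := fun M => by
    refine ⟨Φ (M • I) - Φ I, fun τ => ?_⟩
    have := eq_of_hasWirtingerAt_zero (F := fun z => Φ (M • z) + (-1) * Φ z) (fun τ => ?_) τ I
    · linear_combination this
    · have hd : denom M τ ≠ 0 := denom_ne_zero _ τ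
      have hd' : conj (denom M τ) ≠ 0 := by simp [denom_ne_zero]
      refine (((hΦ (M • τ)).comp_smul M).add ((hΦ τ).const_mul (-1))).congr_coeff ?_ ?_
      · rw [hP]; field_simp; ring
      · rw [hB]; field_simp; ring
  obtain ⟨s, hs⟩ := hc ModularGroup.S
  obtain ⟨t, ht⟩ := hc ModularGroup.T
  have hS2 : ModularGroup.S * ModularGroup.S = -1 := by
    ext i j
    fin_cases i <;> fin_cases j <;> simp [ModularGroup.coe_S, Matrix.mul_apply]
  have hST : (ModularGroup.S * ModularGroup.T) * ((ModularGroup.S * ModularGroup.T) *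
      (ModularGroup.S * ModularGroup.T)) = -1 := by
    ext i j
    fin_cases i <;> fin_cases j <;>
      simp [ModularGroup.coe_S, ModularGroup.coe_T, Matrix.mul_apply]
  -- Since S² = -1 = (ST)³ acts trivially on ℍ, the constants satisfy 2s = 0 and 3s + 3t = 0, whence
  -- t = 0.
  have e1 : Φ ((-1 : SL(2, ℤ)) • τ) = Φ τ + s + s := by
    rw [← hS2, mul_smul, hs, hs]
  have e2 : Φ ((-1 : SL(2, ℤ)) • τ) = Φ τ + 3 * t + 3 * s := by
    rw [← hST]
    simp only [mul_smul, hs, ht]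
    ring
  rw [ModularGroup.SL_neg_smul, one_smul] at e1 e2
  have hs0 : s = 0 := by linear_combination (-1 / 2 : ℂ) * e1
  rw [ht]
  linear_combination (-1 / 3 : ℂ) * e2 - hs0

/-- The point `x + iy` for `y > 0`. -/
def pt (x y : ℝ) : ℍ := ofComplex (x + y * Complex.I)

theorem coe_pt (x : ℝ) {y : ℝ} (hy : 0 < y) : (pt x y : ℂ) = x + y * Complex.I := by
  rw [pt, ofComplex_apply_of_im_pos (by simpa using hy)]

theorem pt_im (x : ℝ) {y : ℝ} (hy : 0 < y) : (pt x y).im = y := by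
  rw [← coe_im, coe_pt x hy]; simp

theorem pt_re_im (τ : ℍ) : pt τ.re τ.im = τ := by
  apply UpperHalfPlane.ext
  rw [coe_pt _ τ.im_pos]
  exact Complex.re_add_im (τ : ℂ)

theorem T_smul_pt (x : ℝ) {y : ℝ} (hy : 0 < y) : ModularGroup.T • pt x y = pt (x + 1) y := by
  apply UpperHalfPlane.ext
  rw [modular_T_smul, coe_vadd, coe_pt _ hy, coe_pt _ hy]
  push_cast; ring

theorem HasWirtingerAt.hasDerivAt_re {F : ℍ → ℂ} {a b : ℂ} {x y : ℝ} (hy : 0 < y)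
    (h : HasWirtingerAt F a b (pt x y)) : HasDerivAt (fun x : ℝ => F (pt x y)) (a + b) x := by
  rw [HasWirtingerAt, coe_pt x hy] at h
  have h1 : HasDerivAt (fun x : ℝ => (x : ℂ) + y * Complex.I) 1 x :=
    (Complex.ofRealCLM.hasDerivAt (x := x)).add_const _ |>.congr_deriv (by simp)
  refine (h.comp_hasDerivAt x h1).congr_deriv ?_
  simp

theorem HasWirtingerAt.hasDerivAt_im {F : ℍ → ℂ} {a b : ℂ} {x y : ℝ} (hy : 0 < y)
    (h : HasWirtingerAt F a b (pt x y)) :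
    HasDerivAt (fun y : ℝ => F (pt x y)) (Complex.I * (a - b)) y := by
  rw [HasWirtingerAt, coe_pt x hy] at h
  have h1 : HasDerivAt (fun y : ℝ => (x : ℂ) + y * Complex.I) Complex.I y :=
    (((Complex.ofRealCLM.hasDerivAt (x := y)).mul_const Complex.I).const_add _).congr_deriv
      (by simp)
  refine (h.comp_hasDerivAt y h1).congr_deriv ?_
  simp; ring

theorem SmoothOnH.continuous_pt {F : ℍ → ℂ} (h : SmoothOnH F) {y : ℝ} (hy : 0 < y) :
    Continuous fun x : ℝ => F (pt x y) :=
  h.continuousOn.comp_continuous (f := fun x : ℝ => (x : ℂ) + y * Complex.I) (by fun_prop)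
    (fun x => by simpa using hy)

/-- On a horizontal segment dτ = dτ̄ = dx, so the integral is Φ(τ + 1) - Φ(τ) for a primitive Φ,
which vanishes by periodicity. -/
theorem integral_eq_zero_of_closed_of_invariant {P B : ℍ → ℂ} (hPs : SmoothOnH P)
    (hBs : SmoothOnH B) (h : ∀ τ, dzb P τ = dz B τ)
    (hP : ∀ (M : SL(2, ℤ)) τ, P (M • τ) = denom M τ ^ 2 * P τ)
    (hB : ∀ (M : SL(2, ℤ)) τ, B (M • τ) = conj (denom M τ) ^ 2 * B τ) {y : ℝ} (hy : 0 < y) :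
    ∫ x in (0 : ℝ)..1, (P (pt x y) + B (pt x y)) = 0 := by
  obtain ⟨Φ, hΦ⟩ := exists_primitive hPs hBs h
  rw [intervalIntegral.integral_eq_sub_of_hasDerivAt
    (fun x _ => (hΦ (pt x y)).hasDerivAt_re hy)
    (((hPs.continuous_pt hy).add (hBs.continuous_pt hy)).intervalIntegrable _ _)]
  have := primitive_periodic hΦ hP hB (pt 0 y)
  rw [T_smul_pt 0 hy, zero_add] at this
  rw [this, sub_self]

/-! ### The closed form attached to a pair of harmonic forms -/

section Vector

variable {D : Type*} [Fintype D]

/-- The integrand is the restriction of the form ω to a horizontal line. The condition on A and A'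
makes the bilinear pairing of the two types invariant; the weights -n and n + 2 of the dτ part add
up to 2, and the holomorphic weights -n and n of the dτ̄ part cancel. -/
theorem integral_pairing_eq_zero [DecidableEq D] {n : ℕ} {f h : ℍ → D → ℂ}
    (hf : ∀ γ, SmoothOnH fun z => f z γ) (hh : ∀ γ, SmoothOnH fun z => h z γ)
    (hfu : ∀ γ τ, dz (dzb fun z => f z γ) τ = n * invTwoIY τ * dzb (fun z => f z γ) τ)
    (hhu : ∀ γ τ, dz (dzb fun z => h z γ) τ = n * invTwoIY τ * dzb (fun z => h z γ) τ)
    (hmod : ∀ M : SL(2, ℤ), ∃ A A' : Matrix D D ℂ, A.transpose * A' = 1 ∧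
      TransformsBy M A (-n) f ∧ TransformsBy M A' (-n) h) {y : ℝ} (hy : 0 < y) :
    ∫ x in (0 : ℝ)..1, (∑ γ, f (pt x y) γ * dz^[n + 1] (fun z => h z γ) (pt x y) +
      ∑ γ, dzb (fun z => f z γ) (pt x y) * raiseIter (-n) n (fun z => h z γ) (pt x y)) = 0 := by
  have hpair : ∀ {A A' : Matrix D D ℂ}, A.transpose * A' = 1 → ∀ v w : D → ℂ,
      ∑ γ, A.mulVec v γ * A'.mulVec w γ = ∑ γ, v γ * w γ := fun {A A'} hA v w => by
    change A.mulVec v ⬝ᵥ A'.mulVec w = v ⬝ᵥ w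
    rw [← Matrix.vecMul_transpose, ← Matrix.dotProduct_mulVec, Matrix.mulVec_mulVec, hA,
      Matrix.one_mulVec]
  have hbol : ∀ γ, raise n (raiseIter (-n) n fun z => h z γ) = dz^[n + 1] fun z => h z γ :=
    fun γ => by
      rw [← raiseIter_eq_iterate_dz (hh γ), raiseIter]
      congr 2 <;> push_cast <;> ring
  refine integral_eq_zero_of_closed_of_invariant (P := fun τ => ∑ γ, f τ γ * dz^[n + 1]
    (fun z => h z γ) τ) (B := fun τ => ∑ γ, dzb (fun z => f z γ) τ *
      raiseIter (-n) n (fun z => h z γ) τ)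
    (SmoothOnH.sum fun γ _ => (hf γ).mul ((hh γ).iterate_dz _))
    (SmoothOnH.sum fun γ _ => (hf γ).dzb.mul ((hh γ).raiseIter _ _)) ?_ ?_ ?_ hy
  · intro τ
    rw [(HasWirtingerAt.sum fun γ _ => ((hf γ).hasWirtingerAt τ).mul
        (((hh γ).iterate_dz (n + 1)).hasWirtingerAt τ)).dzb_eq,
      (HasWirtingerAt.sum fun γ _ => ((hf γ).dzb.hasWirtingerAt τ).mul
        (((hh γ).raiseIter (-n) n).hasWirtingerAt τ)).dz_eq]
    refine Finset.sum_congr rfl fun γ _ => ?_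
    -- Closedness: on one side ∂̄∂^{n+1}h = 0, and on the other the term nE ∂̄f from harmonicity of
    -- f completes ∂(Rⁿh) to R_n(Rⁿh), which is ∂^{n+1}h.
    rw [dzb_iterate_dz (hh γ), iterate_dz_eq_zero (hh γ).dzb (hhu γ), hfu, ← hbol, raise]
    ring
  · intro M τ
    obtain ⟨A, A', hA, h1, h2⟩ := hmod M
    have h3 := h2.raiseIter_apply hh (n + 1)
    have h4 : ∀ τ γ, raiseIter ((-n : ℤ) : ℂ) (n + 1) (fun z => h z γ) τ =
        dz^[n + 1] (fun z => h z γ) τ := fun τ γ => by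
      rw [← raiseIter_eq_iterate_dz (hh γ)]
      congr 1; push_cast; ring
    simp only [h4] at h3
    have hd : denom M τ ≠ 0 := denom_ne_zero _ τ
    have hz : denom M τ ^ (-n : ℤ) * denom M τ ^ (-n + 2 * ((n + 1 : ℕ) : ℤ)) = denom M τ ^ 2 := by
      rw [← zpow_add₀ hd, ← zpow_natCast]; congr 1; push_cast; ring
    rw [← hpair hA (f τ) (fun γ => dz^[n + 1] (fun z => h z γ) τ), Finset.mul_sum]
    refine Finset.sum_congr rfl fun γ _ => ?_
    have h3γ := h3 τ γ
    beta_reduce at h3γ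
    rw [h1 τ γ, h3γ, ← hz]
    ring
  · intro M τ
    obtain ⟨A, A', hA, h1, h2⟩ := hmod M
    have h3 := h2.raiseIter_apply hh n
    have hd : denom M τ ≠ 0 := denom_ne_zero _ τ
    have hz : denom M τ ^ (-n : ℤ) * denom M τ ^ (-n + 2 * (n : ℤ)) = 1 := by
      rw [← zpow_add₀ hd, ← zpow_zero]; congr 1; ring
    push_cast at h3
    rw [← hpair hA (fun γ => dzb (fun z => f z γ) τ)
      (fun γ => raiseIter (-n) n (fun z => h z γ) τ), Finset.mul_sum]
    refine Finset.sum_congr rfl fun γ _ => ?_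
    have h3γ := h3 τ γ
    beta_reduce at h3γ
    rw [h1.dzb_apply hf τ γ, h3γ]
    linear_combination conj (denom M τ) ^ 2 * A.mulVec (fun δ => dzb (fun z => f z δ) τ) γ *
      A'.mulVec (fun γ => raiseIter (-n) n (fun z => h z γ) τ) γ * hz

end Vector

end

noncomputable section

open scoped ComplexConjugate

/-! ### Fourier coefficients along horizontal lines -/

/-- `e(νx)` for real `x`. -/
def fchar (ν : ℚ) (x : ℝ) : ℂ := Complex.exp (2 * Real.pi * Complex.I * (ν : ℂ) * (x : ℂ))

theorem fchar_add (ν μ : ℚ) (x : ℝ) : fchar (ν + μ) x = fchar ν x * fchar μ x := by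
  rw [fchar, fchar, fchar, ← Complex.exp_add]; push_cast; ring_nf

theorem fchar_zero (x : ℝ) : fchar 0 x = 1 := by simp [fchar]

theorem fchar_mul_neg (ν : ℚ) (x : ℝ) : fchar ν x * fchar (-ν) x = 1 := by
  rw [← fchar_add, add_neg_cancel, fchar_zero]

theorem norm_fchar (ν : ℚ) (x : ℝ) : ‖fchar ν x‖ = 1 := by
  rw [fchar, show 2 * Real.pi * Complex.I * (ν : ℂ) * (x : ℂ) = ((2 * Real.pi * ν * x : ℝ) : ℂ) *
    Complex.I by push_cast; ring, Complex.norm_exp_ofReal_mul_I]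

theorem fchar_add_one (ν : ℚ) (x : ℝ) : fchar ν (x + 1) = expUnit ν * fchar ν x := by
  rw [fchar, fchar, expUnit, ← Complex.exp_add]; push_cast; ring_nf

theorem hasDerivAt_fchar (ν : ℚ) (x : ℝ) :
    HasDerivAt (fchar ν) (2 * Real.pi * Complex.I * ν * fchar ν x) x := by
  have h1 : HasDerivAt (fun x : ℝ => 2 * Real.pi * Complex.I * (ν : ℂ) * (x : ℂ))
      (2 * Real.pi * Complex.I * ν) x :=
    ((Complex.ofRealCLM.hasDerivAt (x := x)).const_mul _).congr_deriv (by simp)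
  exact h1.cexp.congr_deriv (mul_comm _ _)

theorem continuous_fchar (ν : ℚ) : Continuous (fchar ν) := by
  unfold fchar; fun_prop

theorem expUnit_int_add (j : ℤ) (q : ℚ) : expUnit (j + q) = expUnit q := by
  rw [expUnit_add, (expUnit_eq_one_iff _).mpr ⟨j, rfl⟩, one_mul]

theorem expUnit_neg_mul (q : ℚ) : expUnit (-q) * expUnit q = 1 := by
  rw [← expUnit_add, neg_add_cancel, expUnit_zero]

theorem integral_fchar_int (j : ℤ) : ∫ x in (0 : ℝ)..1, fchar j x = if j = 0 then 1 else 0 := by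
  split_ifs with h
  · subst h; simp [fchar]
  · have hc : (2 * Real.pi * Complex.I * ((j : ℚ) : ℂ)) ≠ 0 :=
      mul_ne_zero Complex.two_pi_I_ne_zero (by exact_mod_cast h)
    have h1 : ∀ x : ℝ, HasDerivAt (fun x => (2 * Real.pi * Complex.I * ((j : ℚ) : ℂ))⁻¹ * fchar j x)
        (fchar j x) x := fun x =>
      ((hasDerivAt_fchar j x).const_mul _).congr_deriv (by rw [← mul_assoc, inv_mul_cancel₀ hc,
        one_mul])
    rw [intervalIntegral.integral_eq_sub_of_hasDerivAt (fun x _ => h1 x)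
      ((continuous_fchar j).intervalIntegrable _ _)]
    have h2 := fchar_add_one j 0
    rw [zero_add, (expUnit_eq_one_iff _).mpr ⟨j, rfl⟩, one_mul] at h2
    rw [h2, sub_self]

/-- The `ν`-th Fourier coefficient `∫₀¹ F(x + iy) e(-νx) dx`. -/
def fcoeff (ν : ℚ) (F : ℍ → ℂ) (y : ℝ) : ℂ := ∫ x in (0 : ℝ)..1, F (pt x y) * fchar (-ν) x

/-- `F(τ + 1) = e(q) F(τ)`. -/
def QuasiPeriodic (q : ℚ) (F : ℍ → ℂ) : Prop := ∀ τ, F (ModularGroup.T • τ) = expUnit q * F τ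

namespace QuasiPeriodic

variable {q : ℚ} {F G : ℍ → ℂ}

theorem pt_add_one (h : QuasiPeriodic q F) (x : ℝ) {y : ℝ} (hy : 0 < y) :
    F (pt (x + 1) y) = expUnit q * F (pt x y) := by rw [← T_smul_pt x hy, h]

theorem denom_T (τ : ℍ) : denom ModularGroup.T τ = 1 := by
  simp [ModularGroup.denom_apply, ModularGroup.coe_T]

theorem dz_dzb (h : QuasiPeriodic q F) (hF : SmoothOnH F) :
    QuasiPeriodic q (dz F) ∧ QuasiPeriodic q (dzb F) := by
  have key : ∀ τ, _ := fun τ =>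
    (hF.hasWirtingerAt (ModularGroup.T • τ)).comp_smul ModularGroup.T
  rw [show (fun z => F (ModularGroup.T • z)) = fun z => expUnit q * F z from funext h] at key
  refine ⟨fun τ => ?_, fun τ => ?_⟩
  · have := (key τ).dz_eq
    rw [dz_const_mul _ hF, denom_T] at this
    simpa using this.symm
  · have := (key τ).dzb_eq
    rw [dzb_const_mul _ hF, denom_T] at this
    simpa using this.symm

theorem add (h : QuasiPeriodic q F) (h' : QuasiPeriodic q G) :
    QuasiPeriodic q fun z => F z + G z := fun τ => by beta_reduce; rw [h, h']; ring

theorem const_mul (h : QuasiPeriodic q F) (c : ℂ) : QuasiPeriodic q fun z => c * F z :=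
  fun τ => by beta_reduce; rw [h]; ring

theorem invTwoIY_mul (h : QuasiPeriodic q F) : QuasiPeriodic q fun z => invTwoIY z * F z :=
  fun τ => by
    beta_reduce; rw [h, invTwoIY_smul, denom_T]; simp only [map_one]; ring

theorem partialX (h : QuasiPeriodic q F) (hF : SmoothOnH F) : QuasiPeriodic q (partialX F) := by
  have h1 := h.dz_dzb hF
  rw [funext (partialX_eq F)]
  exact h1.1.add h1.2

theorem iterate_dz (h : QuasiPeriodic q F) (hF : SmoothOnH F) (n : ℕ) :
    QuasiPeriodic q (dz^[n] F) := by
  induction n with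
  | zero => exact h
  | succ n ih =>
    rw [Function.iterate_succ_apply']
    exact (ih.dz_dzb (hF.iterate_dz n)).1

theorem raise (h : QuasiPeriodic q F) (hF : SmoothOnH F) (κ : ℂ) :
    QuasiPeriodic q (raise κ F) := by
  convert (h.dz_dzb hF).1.add (h.invTwoIY_mul.const_mul κ) using 1
  funext z; simp only [_root_.raise]; ring

theorem raiseIter (h : QuasiPeriodic q F) (hF : SmoothOnH F) (κ : ℂ) (n : ℕ) :
    QuasiPeriodic q (raiseIter κ n F) := by
  induction n with
  | zero => exact h
  | succ n ih => exact ih.raise (hF.raiseIter κ n) _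

end QuasiPeriodic

/-! ### Differential calculus of Fourier coefficients. -/

section FCoeff

variable {q : ℚ} {F G : ℍ → ℂ} {y : ℝ}

theorem SmoothOnH.continuous_mul_fchar (hF : SmoothOnH F) (ν : ℚ) (hy : 0 < y) :
    Continuous fun x => F (pt x y) * fchar ν x :=
  (hF.continuous_pt hy).mul (continuous_fchar ν)

theorem fcoeff_add (hF : SmoothOnH F) (hG : SmoothOnH G) (ν : ℚ) (hy : 0 < y) :
    fcoeff ν (fun z => F z + G z) y = fcoeff ν F y + fcoeff ν G y := by
  simp only [fcoeff, add_mul]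
  exact intervalIntegral.integral_add ((hF.continuous_mul_fchar _ hy).intervalIntegrable _ _)
    ((hG.continuous_mul_fchar _ hy).intervalIntegrable _ _)

theorem fcoeff_const_mul (c : ℂ) (ν : ℚ) : fcoeff ν (fun z => c * F z) y = c * fcoeff ν F y := by
  simp only [fcoeff, mul_assoc]
  exact intervalIntegral.integral_const_mul _ _

theorem fcoeff_invTwoIY_mul (ν : ℚ) (hy : 0 < y) :
    fcoeff ν (fun z => invTwoIY z * F z) y = 1 / (2 * Complex.I * y) * fcoeff ν F y := by
  rw [← fcoeff_const_mul]
  simp only [fcoeff, invTwoIY, pt_im _ hy]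

theorem norm_fcoeff_le (ν : ℚ) {C : ℝ}
    (hC : ∀ x, ‖F (pt x y)‖ ≤ C) : ‖fcoeff ν F y‖ ≤ C := by
  have := intervalIntegral.norm_integral_le_of_norm_le_const (a := 0) (b := 1) (C := C)
    (f := fun x => F (pt x y) * fchar (-ν) x) fun x _ => by
      rw [norm_mul, norm_fchar, mul_one]; exact hC x
  simpa [fcoeff] using this

theorem norm_fcoeff_le_integral (F : ℍ → ℂ) (ν : ℚ) (y : ℝ) :
    ‖fcoeff ν F y‖ ≤ ∫ x in (0 : ℝ)..1, ‖F (pt x y)‖ := by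
  refine (intervalIntegral.norm_integral_le_integral_norm zero_le_one).trans_eq ?_
  simp only [norm_mul, norm_fchar, mul_one]

/-- Integration by parts; for ν ∈ ℤ + q the factor e(-νx) offsets the multiplier e(q), so the
boundary terms cancel. -/
theorem fcoeff_partialX (hF : SmoothOnH F) (h : QuasiPeriodic q F) (j : ℤ) (hy : 0 < y) :
    fcoeff (j + q) (partialX F) y =
      2 * Real.pi * Complex.I * ((j + q : ℚ) : ℂ) * fcoeff (j + q) F y := by
  set ν : ℚ := j + q with hν
  have hd : ∀ x : ℝ, HasDerivAt (fun x => F (pt x y) * fchar (-ν) x)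
      (partialX F (pt x y) * fchar (-ν) x +
        -(2 * Real.pi * Complex.I * (ν : ℂ)) * (F (pt x y) * fchar (-ν) x)) x := fun x => by
    refine (((hF.hasWirtingerAt (pt x y)).hasDerivAt_re hy).mul
      (hasDerivAt_fchar (-ν) x)).congr_deriv ?_
    rw [partialX_eq]; push_cast; ring
  have hi1 := (hF.partialX.continuous_mul_fchar (-ν) hy).intervalIntegrable
    (μ := MeasureTheory.volume) 0 1
  have hi2 := ((hF.continuous_mul_fchar (-ν) hy).const_mul
    (-(2 * Real.pi * Complex.I * (ν : ℂ)))).intervalIntegrable (μ := MeasureTheory.volume) 0 1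
  have h1 := intervalIntegral.integral_eq_sub_of_hasDerivAt (a := 0) (b := 1)
    (fun x _ => hd x) (hi1.add hi2)
  have h2 : F (pt 1 y) * fchar (-ν) 1 = F (pt 0 y) * fchar (-ν) 0 := by
    have e1 := h.pt_add_one 0 hy
    have e2 := fchar_add_one (-ν) 0
    have e3 := expUnit_neg_mul ν
    rw [zero_add] at e1 e2
    have e4 : expUnit ν = expUnit q := expUnit_int_add j q
    rw [e1, e2, ← e4]
    linear_combination F (pt 0 y) * fchar (-ν) 0 * e3
  rw [intervalIntegral.integral_add hi1 hi2, intervalIntegral.integral_const_mul, h2,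
    sub_self] at h1
  simp only [fcoeff]
  linear_combination h1

theorem hasDerivAt_fcoeff (hF : SmoothOnH F) (ν : ℚ) (hy : 0 < y) :
    HasDerivAt (fcoeff ν F) (fcoeff ν (partialY F) y) y := by
  have hcont : ContinuousOn (fun p : ℝ × ℝ => partialY F (pt p.1 p.2) * fchar (-ν) p.1)
      {p | 0 < p.2} := by
    refine ContinuousOn.mul ?_ ((continuous_fchar _).comp continuous_fst).continuousOn
    exact hF.partialY.continuousOn.comp (f := fun p : ℝ × ℝ => (p.1 : ℂ) + p.2 * Complex.I)
      (by fun_prop) (fun p hp => by simpa using hp)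
  -- A compact neighbourhood of the segment at height y supplies the constant dominating the
  -- derivative under the integral.
  have hK : IsCompact (Set.Icc (0 : ℝ) 1 ×ˢ Set.Icc (y / 2) (2 * y)) :=
    isCompact_Icc.prod isCompact_Icc
  obtain ⟨C, hC⟩ := hK.exists_bound_of_continuousOn (hcont.mono fun p hp => by
    have := hp.2.1
    change 0 < p.2
    linarith)
  have hs : Set.Ioo (y / 2) (2 * y) ∈ nhds y := Ioo_mem_nhds (by linarith) (by linarith)
  refine (intervalIntegral.hasDerivAt_integral_of_dominated_loc_of_deriv_le
    (F := fun y x => F (pt x y) * fchar (-ν) x)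
    (F' := fun y x => partialY F (pt x y) * fchar (-ν) x) (bound := fun _ => C) hs ?_ ?_ ?_ ?_ ?_
    ?_).2
  · filter_upwards [hs] with z hz
    have : 0 < z := by have := hz.1; linarith
    exact (hF.continuous_mul_fchar _ this).aestronglyMeasurable
  · exact (hF.continuous_mul_fchar _ hy).intervalIntegrable _ _
  · exact (hF.partialY.continuous_mul_fchar _ hy).aestronglyMeasurable
  · refine Filter.Eventually.of_forall fun x hx z hz => hC (x, z) ⟨?_, hz.1.le, hz.2.le⟩
    rw [Set.uIoc_of_le zero_le_one] at hx
    exact ⟨hx.1.le, hx.2⟩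
  · exact intervalIntegrable_const
  · refine Filter.Eventually.of_forall fun x _ z hz => ?_
    have hz' : 0 < z := by have := hz.1; linarith
    refine (((hF.hasWirtingerAt (pt x z)).hasDerivAt_im hz').mul_const _).congr_deriv ?_
    rw [partialY_eq]

theorem fcoeff_dz_add_dzb (hF : SmoothOnH F) (h : QuasiPeriodic q F) (j : ℤ) (hy : 0 < y) :
    fcoeff (j + q) (dz F) y + fcoeff (j + q) (dzb F) y =
      2 * Real.pi * Complex.I * ((j + q : ℚ) : ℂ) * fcoeff (j + q) F y := by
  rw [← fcoeff_partialX hF h j hy, funext (partialX_eq F), fcoeff_add hF.dz hF.dzb _ hy]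

/-- Use ∂/∂y = i(∂ - ∂̄) and eliminate ∂ through ∂ + ∂̄ = ∂/∂x, which acts on a mode as a scalar.
The resulting equation in y involves only ∂̄F, about which harmonicity gives information. -/
theorem hasDerivAt_fcoeff' (hF : SmoothOnH F) (h : QuasiPeriodic q F) (j : ℤ) (hy : 0 < y) :
    HasDerivAt (fcoeff (j + q) F) (-(2 * Real.pi * ((j + q : ℚ) : ℂ)) * fcoeff (j + q) F y -
      2 * Complex.I * fcoeff (j + q) (dzb F) y) y := by
  refine (hasDerivAt_fcoeff hF (j + q) hy).congr_deriv ?_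
  have h1 : partialY F = fun z => Complex.I * dz F z + (-Complex.I) * dzb F z := by
    funext z; rw [partialY_eq]; ring
  rw [h1, fcoeff_add (hF.dz.const_mul _) (hF.dzb.const_mul _) _ hy, fcoeff_const_mul,
    fcoeff_const_mul]
  linear_combination Complex.I * fcoeff_dz_add_dzb hF h j hy +
    2 * Real.pi * ((j + q : ℚ) : ℂ) * fcoeff (j + q) F y * Complex.I_sq

end FCoeff

/-! ### Convergence of Fourier series -/

theorem hasSum_fourier_of_periodic {φ : ℝ → ℂ} (hp : Function.Periodic φ 1) (hc : Continuous φ)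
    (hs : Summable fun j : ℤ => ∫ x in (0 : ℝ)..1, φ x * fchar (-j) x) (x : ℝ) :
    HasSum (fun j : ℤ => (∫ x in (0 : ℝ)..1, φ x * fchar (-j) x) * fchar j x) (φ x) := by
  have : Fact ((0 : ℝ) < 1) := ⟨one_pos⟩
  let f : C(AddCircle (1 : ℝ), ℂ) := ⟨hp.lift, continuous_coinduced_dom.mpr hc⟩
  have hf : ∀ x : ℝ, f (x : AddCircle (1 : ℝ)) = φ x := fun x => hp.lift_coe x
  have hfour : ∀ (j : ℤ) (x : ℝ), fourier j (x : AddCircle (1 : ℝ)) = fchar j x := fun j x => by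
    rw [fourier_coe_apply, fchar]; push_cast; ring_nf
  have hcoef : ∀ j : ℤ, fourierCoeff f j = ∫ x in (0 : ℝ)..1, φ x * fchar (-j) x := fun j => by
    rw [fourierCoeff_eq_intervalIntegral _ _ 0]
    simp only [hf, hfour, zero_add, one_smul, div_one, smul_eq_mul]
    refine intervalIntegral.integral_congr fun x _ => ?_
    simp only [Int.cast_neg]; ring
  have := has_pointwise_sum_fourier_series_of_summable (f := f)
    (by simpa only [funext hcoef] using hs) (x : AddCircle (1 : ℝ))
  simpa only [hcoef, hf, hfour, smul_eq_mul] using this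

section Series

variable {q : ℚ} {F G : ℍ → ℂ} {y : ℝ}

theorem summable_fcoeff (hF : SmoothOnH F) (h : QuasiPeriodic q F) (hy : 0 < y) :
    Summable fun j : ℤ => fcoeff (j + q) F y := by
  -- The twisted derivative ∂/∂x - 2πiq multiplies the mode j + q by 2πij; applied twice it gives
  -- decay of order j^{-2}.
  let δ : (ℍ → ℂ) → ℍ → ℂ := fun F z => partialX F z + -(2 * Real.pi * Complex.I * q) * F z
  have hδ : ∀ {F : ℍ → ℂ}, SmoothOnH F → QuasiPeriodic q F → SmoothOnH (δ F) ∧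
      QuasiPeriodic q (δ F) ∧ ∀ j : ℤ, fcoeff (j + q) (δ F) y =
        2 * Real.pi * Complex.I * j * fcoeff (j + q) F y := fun {F} hF h => by
    refine ⟨hF.partialX.add (hF.const_mul _), (h.partialX hF).add (h.const_mul _), fun j => ?_⟩
    simp only [δ]
    rw [fcoeff_add hF.partialX (hF.const_mul _) _ hy, fcoeff_const_mul, fcoeff_partialX hF h j hy]
    push_cast; ring
  obtain ⟨h1, h2, h3⟩ := hδ hF h
  obtain ⟨h4, h5, h6⟩ := hδ h1 h2
  set C := ∫ x in (0 : ℝ)..1, ‖δ (δ F) (pt x y)‖ with hC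
  refine Summable.of_norm_bounded_eventually (g := fun j : ℤ => C * (1 / (j : ℝ) ^ 2))
    ((Real.summable_one_div_int_pow.mpr one_lt_two).mul_left C) ?_
  filter_upwards [(Set.finite_singleton (0 : ℤ)).compl_mem_cofinite] with j (hj : j ≠ 0)
  have hb := norm_fcoeff_le_integral (δ (δ F)) (j + q) y
  rw [h6, h3, ← hC] at hb
  have hj' : (0 : ℝ) < (j : ℝ) ^ 2 := by positivity
  rw [mul_one_div, le_div_iff₀ hj']
  refine le_trans ?_ hb
  simp only [norm_mul, Complex.norm_I, Complex.norm_intCast, Complex.norm_real, Complex.norm_ofNat]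
  have hpi : 1 ≤ 2 * ‖Real.pi‖ := by
    rw [Real.norm_of_nonneg Real.pi_pos.le]; linarith [Real.pi_gt_three]
  have h0 : 0 ≤ ‖fcoeff (j + q) F y‖ * (j : ℝ) ^ 2 := by positivity
  calc ‖fcoeff (j + q) F y‖ * (j : ℝ) ^ 2 ≤ (2 * ‖Real.pi‖) ^ 2 *
        (‖fcoeff (j + q) F y‖ * (j : ℝ) ^ 2) := le_mul_of_one_le_left h0 (one_le_pow₀ hpi)
    _ = _ := by rw [← sq_abs (j : ℝ)]; ring

/-- Multiplication by e(-qx) makes F periodic, which reduces the claim to the ordinary Fourier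
series. -/
theorem hasSum_fcoeff (hF : SmoothOnH F) (h : QuasiPeriodic q F) (hy : 0 < y) (x : ℝ) :
    HasSum (fun j : ℤ => fcoeff (j + q) F y * fchar (j + q) x) (F (pt x y)) := by
  let φ : ℝ → ℂ := fun x => F (pt x y) * fchar (-q) x
  have hp : Function.Periodic φ 1 := fun x => by
    simp only [φ]
    rw [h.pt_add_one x hy, fchar_add_one]
    linear_combination F (pt x y) * fchar (-q) x * expUnit_neg_mul q
  have hcoef : ∀ j : ℤ, ∫ x in (0 : ℝ)..1, φ x * fchar (-j) x = fcoeff (j + q) F y := fun j => by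
    refine intervalIntegral.integral_congr fun x _ => ?_
    simp only [φ]
    rw [neg_add_rev, fchar_add, mul_assoc]
  have h1 := hasSum_fourier_of_periodic hp (hF.continuous_mul_fchar _ hy)
    (by simpa only [hcoef] using summable_fcoeff hF h hy) x
  simp only [hcoef] at h1
  have h2 := h1.mul_right (fchar q x)
  simp only [φ] at h2
  rw [mul_assoc, mul_comm (fchar (-q) x), fchar_mul_neg, mul_one] at h2
  refine h2.congr_fun fun j => ?_
  rw [fchar_add, mul_assoc]

theorem hasSum_integral_mul {ι : Type*} [Countable ι] {a : ι → ℂ} {e : ι → ℚ} {φ G : ℝ → ℂ}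
    (hG : Continuous G) (ha : ∀ x, HasSum (fun i => a i * fchar (e i) x) (φ x)) :
    HasSum (fun i => a i * ∫ x in (0 : ℝ)..1, G x * fchar (e i) x)
      (∫ x in (0 : ℝ)..1, φ x * G x) := by
  obtain ⟨C, hC⟩ := (isCompact_Icc (a := (0 : ℝ)) (b := 1)).exists_bound_of_continuousOn
    hG.continuousOn
  -- The terms have norm independent of x, so convergence at the single point x = 0 dominates the
  -- series for all x.
  have hsum : Summable fun i => ‖a i‖ * C := by
    refine Summable.mul_right C ?_
    simpa [fchar] using (ha 0).summable.norm
  have := intervalIntegral.hasSum_integral_of_dominated_convergence (a := 0) (b := 1)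
    (μ := MeasureTheory.volume) (F := fun i x => a i * (G x * fchar (e i) x))
    (f := fun x => φ x * G x)
    (fun i _ => ‖a i‖ * C) (fun i => ?_) (fun i => ?_) ?_ ?_ ?_
  · simpa only [intervalIntegral.integral_const_mul] using this
  · exact (continuous_const.mul (hG.mul (continuous_fchar _))).aestronglyMeasurable
  · refine Filter.Eventually.of_forall fun x hx => ?_
    rw [Set.uIoc_of_le zero_le_one] at hx
    rw [norm_mul, norm_mul, norm_fchar, mul_one]
    exact mul_le_mul_of_nonneg_left (hC x ⟨hx.1.le, hx.2⟩) (norm_nonneg _)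
  · exact Filter.Eventually.of_forall fun _ _ => hsum
  · exact intervalIntegrable_const
  · refine Filter.Eventually.of_forall fun x _ => ((ha x).mul_right (G x)).congr_fun fun i => ?_
    ring

/-- Parseval's identity. -/
theorem hasSum_fcoeff_mul_fcoeff (hF : SmoothOnH F) (h : QuasiPeriodic q F) (hG : SmoothOnH G)
    (hy : 0 < y) : HasSum (fun j : ℤ => fcoeff (j + q) F y * fcoeff (-(j + q)) G y)
      (∫ x in (0 : ℝ)..1, F (pt x y) * G (pt x y)) := by
  refine (hasSum_integral_mul (hG.continuous_pt hy) (hasSum_fcoeff hF h hy)).congr_fun fun j => ?_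
  simp only [fcoeff, neg_neg]

/-- Uniqueness of Fourier coefficients. -/
theorem fcoeff_eq_of_hasSum {a : ℚ → ℂ} (ha : ∀ n, a n ≠ 0 → ∃ j : ℤ, n = j + q)
    (h : ∀ x, HasSum (fun n => a n * fchar n x) (F (pt x y))) (j : ℤ) :
    fcoeff (j + q) F y = a (j + q) := by
  have h1 := hasSum_integral_mul (continuous_fchar (-(j + q))) h
  refine h1.unique ?_
  convert! hasSum_single (j + q : ℚ) (f := fun n => a n *
    ∫ x in (0 : ℝ)..1, fchar (-(j + q)) x * fchar n x) ?_ using 1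
  · simp only [← fchar_add, neg_add_cancel, fchar_zero]; simp
  · intro n hn
    by_cases h0 : a n = 0
    · simp [h0]
    · obtain ⟨i, rfl⟩ := ha n h0
      have hij : i - j ≠ 0 := fun hij => hn (by rw [sub_eq_zero.mp hij])
      have h2 : ∀ x, fchar (-(j + q)) x * fchar (i + q) x = fchar (i - j : ℤ) x := fun x => by
        rw [← fchar_add]; congr 1; push_cast; ring
      simp only [h2, integral_fchar_int, if_neg hij, mul_zero]

end Series

end

noncomputable section

open scoped ComplexConjugate
open Filter Topology

/-! ### Exponentials and the incomplete Gamma function -/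

theorem eq_of_hasDerivAt_zero_of_pos {f : ℝ → ℂ} (h : ∀ y, 0 < y → HasDerivAt f 0 y) {x y : ℝ}
    (hx : 0 < x) (hy : 0 < y) : f x = f y :=
  isOpen_Ioi.is_const_of_deriv_eq_zero (s := Set.Ioi (0 : ℝ)) isPreconnected_Ioi
    (fun z hz => (h z hz).differentiableAt.differentiableWithinAt) (fun z hz => (h z hz).deriv)
    hx hy

theorem eq_of_hasDerivAt_zero_of_tendsto {f : ℝ → ℂ} {c : ℂ}
    (h : ∀ y, 0 < y → HasDerivAt f 0 y) (hc : Tendsto f atTop (𝓝 c)) {y : ℝ} (hy : 0 < y) :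
    f y = c := by
  refine tendsto_nhds_unique ?_ hc
  refine tendsto_const_nhds.congr' ?_
  filter_upwards [eventually_gt_atTop 0] with x hx
  exact eq_of_hasDerivAt_zero_of_pos h hy hx

/-- `e^{2πνy}`. -/
def expHeight (ν : ℚ) (y : ℝ) : ℂ := Complex.exp (2 * Real.pi * (ν : ℂ) * (y : ℂ))

theorem expHeight_add (ν μ : ℚ) (y : ℝ) : expHeight (ν + μ) y = expHeight ν y * expHeight μ y := by
  rw [expHeight, expHeight, expHeight, ← Complex.exp_add]; push_cast; ring_nf

theorem expHeight_mul_neg (ν : ℚ) (y : ℝ) : expHeight ν y * expHeight (-ν) y = 1 := by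
  rw [← expHeight_add, add_neg_cancel, expHeight]; simp

theorem expHeight_eq_ofReal (ν : ℚ) (y : ℝ) :
    expHeight ν y = (Real.exp (2 * Real.pi * ν * y) : ℝ) := by
  rw [expHeight]; push_cast; rfl

theorem norm_expHeight (ν : ℚ) (y : ℝ) : ‖expHeight ν y‖ = Real.exp (2 * Real.pi * ν * y) := by
  rw [expHeight_eq_ofReal, Complex.norm_real, Real.norm_of_nonneg (Real.exp_pos _).le]

theorem hasDerivAt_expHeight (ν : ℚ) (y : ℝ) :
    HasDerivAt (expHeight ν) (2 * Real.pi * ν * expHeight ν y) y := by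
  have h1 : HasDerivAt (fun y : ℝ => 2 * Real.pi * (ν : ℂ) * (y : ℂ)) (2 * Real.pi * ν) y :=
    ((Complex.ofRealCLM.hasDerivAt (x := y)).const_mul _).congr_deriv (by simp)
  exact h1.cexp.congr_deriv (mul_comm _ _)

theorem expTau_pt (ν : ℚ) (x : ℝ) {y : ℝ} (hy : 0 < y) :
    expTau ν (pt x y) = expHeight (-ν) y * fchar ν x := by
  rw [expTau, expHeight, fchar, ← Complex.exp_add, coe_pt x hy]
  congr 1
  push_cast
  linear_combination 2 * Real.pi * (ν : ℂ) * y * Complex.I_sq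

theorem tendsto_pow_mul_exp_neg_mul (n : ℕ) {c : ℝ} (hc : 0 < c) :
    Tendsto (fun y : ℝ => y ^ n * Real.exp (-(c * y))) atTop (𝓝 0) := by
  have h := ((Real.tendsto_pow_mul_exp_neg_atTop_nhds_zero n).comp
    (tendsto_id.const_mul_atTop hc)).const_mul ((c ^ n)⁻¹)
  rw [mul_zero] at h
  refine h.congr fun y => ?_
  simp only [Function.comp_apply, id, mul_pow]
  field_simp

theorem tendsto_pow_mul_expHeight (n : ℕ) {ν : ℚ} (hν : ν < 0) :
    Tendsto (fun y : ℝ => (y : ℂ) ^ n * expHeight ν y) atTop (𝓝 0) := by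
  have hc : (0 : ℝ) < 2 * Real.pi * -ν := by
    have : (0 : ℝ) < -ν := by exact_mod_cast neg_pos.mpr hν
    positivity
  have h := (Complex.continuous_ofReal.tendsto 0).comp (tendsto_pow_mul_exp_neg_mul n hc)
  rw [Complex.ofReal_zero] at h
  refine h.congr fun y => ?_
  rw [expHeight_eq_ofReal]
  simp only [Function.comp_apply]
  push_cast
  ring_nf

theorem tendsto_expHeight {ν : ℚ} (hν : ν < 0) : Tendsto (expHeight ν) atTop (𝓝 0) := by
  simpa using tendsto_pow_mul_expHeight 0 hν

/-- Γ(a, x) is the full Gamma integral minus ∫₀ˣ; convergence of the latter at 0 is where a > 0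
enters. -/
theorem hasDerivAt_incGamma {a x : ℝ} (ha : 0 < a) (hx : 0 < x) :
    HasDerivAt (incGamma a) (-(Real.exp (-x) * x ^ (a - 1))) x := by
  have hint := Real.GammaIntegral_convergent ha
  have hcont : ContinuousOn (fun t : ℝ => Real.exp (-t) * t ^ (a - 1)) (Set.Ioi 0) := fun t ht =>
    ((Real.continuous_exp.comp continuous_neg).continuousAt.mul
      (Real.continuousAt_rpow_const t _ (Or.inl (ne_of_gt ht)))).continuousWithinAt
  have h1 : HasDerivAt (fun u => ∫ t in (0 : ℝ)..u, Real.exp (-t) * t ^ (a - 1))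
      (Real.exp (-x) * x ^ (a - 1)) x := by
    refine intervalIntegral.integral_hasDerivAt_right ?_ ?_
      (hcont.continuousAt (isOpen_Ioi.mem_nhds hx))
    · rw [intervalIntegrable_iff_integrableOn_Ioc_of_le hx.le]
      exact hint.mono_set Set.Ioc_subset_Ioi_self
    · exact hcont.stronglyMeasurableAtFilter isOpen_Ioi x hx
  refine ((h1.const_sub (∫ t in Set.Ioi (0 : ℝ), Real.exp (-t) * t ^ (a - 1)))).congr_of_eventuallyEq
    ?_
  filter_upwards [isOpen_Ioi.mem_nhds hx] with u hu
  rw [← intervalIntegral.integral_Ioi_sub_Ioi hint (le_of_lt hu), incGamma]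
  ring

theorem tendsto_incGamma {a : ℝ} (ha : 0 < a) : Tendsto (incGamma a) atTop (𝓝 0) := by
  have hint := Real.GammaIntegral_convergent ha
  have h := (MeasureTheory.intervalIntegral_tendsto_integral_Ioi 0 hint tendsto_id).const_sub
    (∫ t in Set.Ioi (0 : ℝ), Real.exp (-t) * t ^ (a - 1))
  rw [sub_self] at h
  refine h.congr' ?_
  filter_upwards [eventually_ge_atTop 0] with u hu
  simp only [id]
  rw [← intervalIntegral.integral_Ioi_sub_Ioi hint hu, incGamma]
  ring

theorem tendsto_incGamma_mul {a c : ℝ} (ha : 0 < a) (hc : 0 < c) :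
    Tendsto (fun y : ℝ => (incGamma a (c * y) : ℂ)) atTop (𝓝 0) := by
  have h := (Complex.continuous_ofReal.tendsto 0).comp
    ((tendsto_incGamma ha).comp (tendsto_id.const_mul_atTop hc))
  rwa [Complex.ofReal_zero] at h

/-! ### The Fourier coefficients of a harmonic function -/

section Harmonic

variable {q : ℚ} {F : ℍ → ℂ} {n : ℕ}

theorem fcoeff_mul_invTwoIY_mul {G : ℍ → ℂ} (c : ℂ) (ν : ℚ) {y : ℝ} (hy : 0 < y) :
    fcoeff ν (fun z => c * invTwoIY z * G z) y = c / (2 * Complex.I * y) * fcoeff ν G y := by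
  have : (fun z => c * invTwoIY z * G z) = fun z => c * (invTwoIY z * G z) :=
    funext fun z => mul_assoc _ _ _
  rw [this, fcoeff_const_mul, fcoeff_invTwoIY_mul _ hy]
  ring

/-- Harmonicity prescribes ∂ of ∂̄F, so the unknown ∂̄∂̄F can be eliminated and the mode satisfies a
closed linear equation. -/
theorem hasDerivAt_fcoeff_dzb (hF : SmoothOnH F) (h : QuasiPeriodic q F)
    (hu : ∀ τ, dz (dzb F) τ = n * invTwoIY τ * dzb F τ) (j : ℤ) {y : ℝ} (hy : 0 < y) :
    HasDerivAt (fcoeff (j + q) (dzb F))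
      ((2 * Real.pi * ((j + q : ℚ) : ℂ) + n / y) * fcoeff (j + q) (dzb F) y) y := by
  have hq := (h.dz_dzb hF).2
  refine (hasDerivAt_fcoeff' hF.dzb hq j hy).congr_deriv ?_
  have h1 := fcoeff_dz_add_dzb hF.dzb hq j hy
  rw [funext hu, fcoeff_mul_invTwoIY_mul _ _ hy] at h1
  have hy' : (y : ℂ) ≠ 0 := by exact_mod_cast hy.ne'
  have h2 : (n : ℂ) / (2 * Complex.I * y) = -Complex.I / 2 * (n / y) := by
    field_simp; simp
  rw [h2] at h1
  linear_combination -2 * Complex.I * h1 - (4 * Real.pi * ((j + q : ℚ) : ℂ) + n / y) *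
    fcoeff (j + q) (dzb F) y * Complex.I_sq

/-- The equation b' = (2πν + n/y)b has the one-dimensional solution space spanned by yⁿe^{2πνy}; the
proof divides b by that solution. -/
theorem exists_fcoeff_dzb_eq (hF : SmoothOnH F) (h : QuasiPeriodic q F)
    (hu : ∀ τ, dz (dzb F) τ = n * invTwoIY τ * dzb F τ) (j : ℤ) :
    ∃ β : ℂ, ∀ y, 0 < y → fcoeff (j + q) (dzb F) y = β * (y : ℂ) ^ n * expHeight (j + q) y := by
  set ν : ℚ := j + q with hν
  have hd : ∀ y, 0 < y → HasDerivAt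
      (fun y : ℝ => fcoeff ν (dzb F) y * (expHeight (-ν) y * ((y : ℂ)⁻¹) ^ n)) 0 y := fun y hy => by
    have hy' : (y : ℂ) ≠ 0 := by exact_mod_cast hy.ne'
    have h1 : HasDerivAt (fun y : ℝ => ((y : ℂ)⁻¹) ^ n) (-(n / y) * ((y : ℂ)⁻¹) ^ n) y := by
      have h2 : HasDerivAt (fun y : ℝ => ((y : ℂ)⁻¹)) (-((y : ℂ) ^ 2)⁻¹) y :=
        ((hasDerivAt_inv hy').comp_ofReal)
      refine (h2.pow n).congr_deriv ?_
      cases n with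
      | zero => simp
      | succ n => push_cast; rw [pow_succ _ n]; field_simp
    refine ((hasDerivAt_fcoeff_dzb hF h hu j hy).mul
      ((hasDerivAt_expHeight (-ν) y).mul h1)).congr_deriv ?_
    rw [← hν]
    simp only [Pi.mul_apply]
    push_cast
    ring
  refine ⟨fcoeff ν (dzb F) 1 * (expHeight (-ν) 1 * (((1 : ℝ) : ℂ)⁻¹) ^ n), fun y hy => ?_⟩
  rw [eq_of_hasDerivAt_zero_of_pos hd one_pos hy]
  have hy' : (y : ℂ) ^ n ≠ 0 := pow_ne_zero _ (by exact_mod_cast hy.ne')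
  have := expHeight_mul_neg ν y
  rw [inv_pow]
  field_simp
  linear_combination -fcoeff ν (dzb F) y * this

theorem hasDerivAt_fcoeff_mul_expHeight (hF : SmoothOnH F) (h : QuasiPeriodic q F) (j : ℤ) {y : ℝ}
    (hy : 0 < y) : HasDerivAt (fun y => fcoeff (j + q) F y * expHeight (j + q) y)
      (-2 * Complex.I * (fcoeff (j + q) (dzb F) y * expHeight (j + q) y)) y := by
  refine ((hasDerivAt_fcoeff' hF h j hy).mul (hasDerivAt_expHeight (j + q) y)).congr_deriv ?_
  ring

/-- A function with derivative `C yⁿ e^{4πνy}`, `ν ≥ 0`, which is `O(e^{2πνy})` has `C = 0`. -/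
theorem eq_zero_of_growth {A : ℝ → ℂ} {C : ℂ} {ν : ℚ} (hν : 0 ≤ ν)
    (hA : ∀ y : ℝ, 0 < y → HasDerivAt A (C * ((y : ℂ) ^ n * expHeight (2 * ν) y)) y) {K Y : ℝ}
    (hK : ∀ y, Y ≤ y → ‖A y‖ ≤ K * Real.exp (2 * Real.pi * ν * y)) : C = 0 := by
  have hν' : (0 : ℝ) ≤ 2 * Real.pi * ν := by
    have : (0 : ℝ) ≤ ν := by exact_mod_cast hν
    positivity
  -- Compare A(y) - A(y/2) with the integral over [y/2, y], where tⁿ ≥ 1 and e^{4πνt} ≥ e^{2πνy}.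
  -- The length y/2 of the interval is the gain that contradicts the bound, also for ν = 0.
  have key : ∀ y, 2 ≤ y → 2 * Y ≤ y → ‖C‖ * (y / 2) ≤ 2 * K := fun y hy hY => by
    have hint : ∀ a b, IntervalIntegrable (fun t : ℝ => t ^ n * Real.exp (2 * Real.pi * (2 * ν) * t))
        MeasureTheory.volume a b := fun a b => Continuous.intervalIntegrable (by fun_prop) _ _
    have hint' : ∀ a b, IntervalIntegrable (fun t : ℝ => C * ((t : ℂ) ^ n * expHeight (2 * ν) t))
        MeasureTheory.volume a b := fun a b =>
      Continuous.intervalIntegrable (by unfold expHeight; fun_prop) _ _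
    have h1 : ∫ t in (y / 2)..y, C * ((t : ℂ) ^ n * expHeight (2 * ν) t) = A y - A (y / 2) := by
      refine intervalIntegral.integral_eq_sub_of_hasDerivAt (fun t ht => hA t ?_) (hint' _ _)
      rw [Set.uIcc_of_le (by linarith)] at ht
      linarith [ht.1]
    have h2 : ∫ t in (y / 2)..y, C * ((t : ℂ) ^ n * expHeight (2 * ν) t) =
        C * ((∫ t in (y / 2)..y, t ^ n * Real.exp (2 * Real.pi * (2 * ν) * t) : ℝ) : ℂ) := by
      rw [intervalIntegral.integral_const_mul, ← intervalIntegral.integral_ofReal]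
      congr 1
      refine intervalIntegral.integral_congr fun t _ => ?_
      simp only [expHeight_eq_ofReal]
      push_cast; rfl
    have h3 : (y / 2) * Real.exp (2 * Real.pi * ν * y) ≤
        ∫ t in (y / 2)..y, t ^ n * Real.exp (2 * Real.pi * (2 * ν) * t) := by
      have := intervalIntegral.integral_mono_on (a := y / 2) (b := y)
        (f := fun _ => Real.exp (2 * Real.pi * ν * y)) (by linarith) intervalIntegrable_const
        (hint _ _) (fun t ht => by
          have ht1 : (1 : ℝ) ≤ t := by linarith [ht.1]
          calc Real.exp (2 * Real.pi * ν * y) ≤ Real.exp (2 * Real.pi * (2 * ν) * t) := by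
                apply Real.exp_le_exp.mpr
                nlinarith [ht.1]
            _ ≤ _ := le_mul_of_one_le_left (Real.exp_pos _).le (one_le_pow₀ ht1))
      refine le_trans (le_of_eq ?_) this
      rw [intervalIntegral.integral_const, smul_eq_mul]; ring
    have h4 : ‖A y - A (y / 2)‖ ≤ 2 * K * Real.exp (2 * Real.pi * ν * y) := by
      have hK0 : 0 ≤ K := by
        have := (norm_nonneg _).trans (hK y (by linarith))
        exact nonneg_of_mul_nonneg_left this (Real.exp_pos _)
      have h5 := hK y (by linarith)
      have h6 := hK (y / 2) (by linarith)
      have h7 : Real.exp (2 * Real.pi * ν * (y / 2)) ≤ Real.exp (2 * Real.pi * ν * y) :=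
        Real.exp_le_exp.mpr (by nlinarith)
      have h8 := mul_le_mul_of_nonneg_left h7 hK0
      linarith [norm_sub_le (A y) (A (y / 2))]
    rw [← h1, h2, norm_mul, Complex.norm_real] at h4
    have h9 := mul_le_mul_of_nonneg_left (h3.trans (Real.le_norm_self _)) (norm_nonneg C)
    have h10 := h9.trans h4
    rw [← mul_assoc] at h10
    exact le_of_mul_le_mul_right h10 (Real.exp_pos _)
  by_contra hC
  have hC' : 0 < ‖C‖ := norm_pos_iff.mpr hC
  have h1 := key (max 2 (max (2 * Y) (2 * (2 * K + 1) / ‖C‖))) (le_max_left _ _)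
    ((le_max_left _ _).trans (le_max_right _ _))
  have h2 : 2 * (2 * K + 1) / ‖C‖ ≤ max 2 (max (2 * Y) (2 * (2 * K + 1) / ‖C‖)) :=
    (le_max_right _ _).trans (le_max_right _ _)
  rw [div_le_iff₀ hC'] at h2
  nlinarith

theorem eq_incGamma_of_hasDerivAt {A : ℝ → ℂ} {C p : ℂ} {ν : ℚ} (hν : ν < 0)
    (hA : ∀ y : ℝ, 0 < y → HasDerivAt A (C * ((y : ℂ) ^ n * expHeight (2 * ν) y)) y)
    (hp : Tendsto A atTop (𝓝 p)) : ∃ c : ℂ, ∀ y, 0 < y →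
      A y = p + c * (incGamma (n + 1) (4 * Real.pi * |(ν : ℝ)| * y) : ℂ) := by
  have hν' : (ν : ℝ) < 0 := by exact_mod_cast hν
  set s : ℝ := 4 * Real.pi * |(ν : ℝ)| with hs
  have hs0 : 0 < s := by
    have : 0 < |(ν : ℝ)| := abs_pos.mpr hν'.ne
    positivity
  have hn : (0 : ℝ) < n + 1 := by positivity
  have hsn : ((s : ℂ)) ^ (n + 1) ≠ 0 := pow_ne_zero _ (by exact_mod_cast hs0.ne')
  -- The derivative of Γ(n + 1, sy) is -s^{n+1}yⁿe^{-sy}, and e^{-sy} = e^{4πνy}; this constant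
  -- matches the derivative of A.
  refine ⟨-(C / (s : ℂ) ^ (n + 1)), fun y hy => ?_⟩
  have hd : ∀ y, 0 < y → HasDerivAt (fun y => A y - -(C / (s : ℂ) ^ (n + 1)) *
      (incGamma (n + 1) (s * y) : ℂ)) 0 y := fun y hy => by
    have h1 := (hasDerivAt_incGamma hn (mul_pos hs0 hy)).comp y ((hasDerivAt_id y).const_mul s)
    have h2 := (h1.ofReal_comp).const_mul (-(C / (s : ℂ) ^ (n + 1)))
    refine ((hA y hy).sub h2).congr_deriv ?_
    rw [add_sub_cancel_right, Real.rpow_natCast, expHeight_eq_ofReal]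
    have h3 : Real.exp (-(s * y)) = Real.exp (2 * Real.pi * ((2 * ν : ℚ) : ℝ) * y) := by
      congr 1
      rw [hs, abs_of_neg hν']; push_cast; ring
    rw [h3]
    push_cast
    field_simp
    ring
  have ht : Tendsto (fun y => A y - -(C / (s : ℂ) ^ (n + 1)) * (incGamma (n + 1) (s * y) : ℂ))
      atTop (𝓝 p) := by
    simpa using hp.sub ((tendsto_incGamma_mul hn hs0).const_mul (-(C / (s : ℂ) ^ (n + 1))))
  linear_combination eq_of_hasDerivAt_zero_of_tendsto hd ht hy

/-- The asymptotic condition on a single component of a harmonic weak Maass form. -/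
def HasGrowth (q : ℚ) (F : ℍ → ℂ) (P : ℚ →₀ ℂ) : Prop :=
  (∀ ν, P ν ≠ 0 → (∃ j : ℤ, ν = j + q) ∧ ν ≤ 0) ∧
    ∃ ε : ℝ, 0 < ε ∧ (fun τ : ℍ => F τ - P.sum fun n a => a * expTau n τ)
      =O[atImInfty] fun τ : ℍ => Real.exp (-ε * τ.im)

theorem fcoeff_finsuppSum {P : ℚ →₀ ℂ} (hP : ∀ ν, P ν ≠ 0 → ∃ j : ℤ, ν = j + q) (j : ℤ) {y : ℝ}
    (hy : 0 < y) : fcoeff (j + q) (fun τ => P.sum fun n a => a * expTau n τ) y =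
      P (j + q) * expHeight (-(j + q)) y := by
  refine fcoeff_eq_of_hasSum (q := q) (a := fun n => P n * expHeight (-n) y)
    (fun n hn => hP n (left_ne_zero_of_mul hn)) (fun x => ?_) j
  have := hasSum_sum_of_ne_finset_zero (L := .unconditional ℚ)
    (f := fun n => P n * expHeight (-n) y * fchar n x) (s := P.support)
    fun n hn => by simp [Finsupp.notMem_support_iff.mp hn]
  convert! this using 1
  exact Finset.sum_congr rfl fun n _ => by beta_reduce; rw [expTau_pt n x hy, mul_assoc]

theorem smoothOnH_expTau (ν : ℚ) : SmoothOnH (expTau ν) :=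
  SmoothOnH.of_contDiffOn (f := fun z => Complex.exp (2 * Real.pi * Complex.I * (ν : ℂ) * z))
    (by fun_prop)

/-- The O-term is uniform in x, so it passes to every Fourier coefficient with the same constants.
-/
theorem HasGrowth.norm_fcoeff_sub_le {P : ℚ →₀ ℂ} (hP : HasGrowth q F P) (hF : SmoothOnH F) :
    ∃ C Y ε : ℝ, 0 < ε ∧ ∀ y, Y ≤ y → ∀ j : ℤ,
      ‖fcoeff (j + q) F y * expHeight (j + q) y - P (j + q)‖ ≤
        C * Real.exp (-ε * y) * Real.exp (2 * Real.pi * (j + q : ℚ) * y) := by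
  obtain ⟨hsupp, ε, hε, hO⟩ := hP
  obtain ⟨C, hC⟩ := hO.bound
  rw [Filter.Eventually, atImInfty_mem] at hC
  obtain ⟨Y, hY⟩ := hC
  refine ⟨C, max Y 1, ε, hε, fun y hy j => ?_⟩
  have hy0 : 0 < y := lt_of_lt_of_le one_pos ((le_max_right _ _).trans hy)
  have hPs : SmoothOnH fun τ => P.sum fun n a => a * expTau n τ :=
    SmoothOnH.sum fun i _ => (smoothOnH_expTau i).const_mul _
  have h1 : ‖fcoeff (j + q) (fun τ => F τ + (-1) * P.sum fun n a => a * expTau n τ) y‖ ≤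
      C * Real.exp (-ε * y) := norm_fcoeff_le _ fun x => by
    have := hY (pt x y) (by rw [pt_im x hy0]; exact (le_max_left _ _).trans hy)
    simp only [Set.mem_ofPred_eq, pt_im x hy0, Real.norm_of_nonneg (Real.exp_pos _).le] at this
    rwa [neg_one_mul, ← sub_eq_add_neg]
  rw [fcoeff_add hF (hPs.const_mul _) _ hy0, fcoeff_const_mul,
    fcoeff_finsuppSum (fun ν hν => (hsupp ν hν).1) j hy0] at h1
  rw [← norm_expHeight]
  refine le_trans (le_of_eq ?_) (mul_le_mul_of_nonneg_right h1 (norm_nonneg _))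
  rw [← norm_mul]
  congr 1
  linear_combination P (j + q) * expHeight_mul_neg (j + q) y

theorem HasGrowth.tendsto_fcoeff {P : ℚ →₀ ℂ} (hP : HasGrowth q F P) (hF : SmoothOnH F) (j : ℤ)
    (hj : (j + q : ℚ) ≤ 0) :
    Tendsto (fun y => fcoeff (j + q) F y * expHeight (j + q) y) atTop (𝓝 (P (j + q))) := by
  obtain ⟨C, Y, ε, hε, h⟩ := hP.norm_fcoeff_sub_le hF
  rw [tendsto_iff_norm_sub_tendsto_zero]
  have h0 : Tendsto (fun y : ℝ => |C| * Real.exp (-(ε * y))) atTop (𝓝 0) := by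
    simpa using (tendsto_pow_mul_exp_neg_mul 0 hε).const_mul |C|
  refine squeeze_zero' (Eventually.of_forall fun _ => norm_nonneg _) ?_ h0
  filter_upwards [eventually_ge_atTop (max Y 0)] with y hy
  refine (h y ((le_max_left _ _).trans hy) j).trans ?_
  have hy0 : 0 ≤ y := (le_max_right _ _).trans hy
  have h1 : Real.exp (2 * Real.pi * ((j + q : ℚ) : ℝ) * y) ≤ 1 := by
    rw [Real.exp_le_one_iff]
    have : ((j + q : ℚ) : ℝ) ≤ 0 := by exact_mod_cast hj
    exact mul_nonpos_of_nonpos_of_nonneg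
      (mul_nonpos_of_nonneg_of_nonpos (by positivity) this) hy0
  rw [neg_mul]
  calc _ ≤ |C| * Real.exp (-(ε * y)) * Real.exp (2 * Real.pi * ((j + q : ℚ) : ℝ) * y) := by
        gcongr; exact le_abs_self C
    _ ≤ _ := mul_le_of_le_one_right (by positivity) h1

/-- Let A be the coefficient times e^{2πνy}; then A' is a constant times yⁿe^{4πνy}. For ν ≥ 0 the
growth condition allows only O(e^{2πνy}), so A is constant. For ν < 0, A tends to P(ν) and differs
from it by a multiple of the incomplete Gamma function. The identification with P(ν) is kept because
it bounds the principal part. -/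
theorem exists_fcoeff_eq {P : ℚ →₀ ℂ} (hF : SmoothOnH F) (h : QuasiPeriodic q F)
    (hu : ∀ τ, dz (dzb F) τ = n * invTwoIY τ * dzb F τ) (hP : HasGrowth q F P) (j : ℤ) :
    ∃ cp cm : ℂ, (0 ≤ (j + q : ℚ) → cm = 0) ∧ ((j + q : ℚ) < 0 → cp = P (j + q)) ∧
      ∀ y, 0 < y → fcoeff (j + q) F y =
        (cp + cm * (incGamma (n + 1) (4 * Real.pi * |((j + q : ℚ) : ℝ)| * y) : ℂ)) *
          expHeight (-(j + q)) y := by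
  obtain ⟨β, hβ⟩ := exists_fcoeff_dzb_eq hF h hu j
  set ν : ℚ := j + q with hν
  have hA : ∀ y : ℝ, 0 < y → HasDerivAt (fun y => fcoeff ν F y * expHeight ν y)
      (-2 * Complex.I * β * ((y : ℂ) ^ n * expHeight (2 * ν) y)) y := fun y hy => by
    refine (hasDerivAt_fcoeff_mul_expHeight hF h j hy).congr_deriv ?_
    rw [← hν, hβ y hy, two_mul ν, expHeight_add ν ν]
    ring
  have hback : ∀ {c : ℂ} {y : ℝ}, fcoeff ν F y * expHeight ν y = c →
      fcoeff ν F y = c * expHeight (-ν) y := fun {c y} hc => by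
    rw [← hc, mul_assoc, expHeight_mul_neg, mul_one]
  rcases le_or_gt 0 ν with h0 | h0
  · obtain ⟨C, Y, ε, hε, hb⟩ := hP.norm_fcoeff_sub_le hF
    have hC : -2 * Complex.I * β = 0 := by
      refine eq_zero_of_growth (K := ‖P ν‖ + |C|) (Y := max Y 0) h0 hA fun y hy => ?_
      have h1 := hb y ((le_max_left _ _).trans hy) j
      have hy0 : 0 ≤ y := (le_max_right _ _).trans hy
      have h2 : Real.exp (-ε * y) ≤ 1 := by rw [Real.exp_le_one_iff]; nlinarith
      have h3 : 1 ≤ Real.exp (2 * Real.pi * ν * y) := by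
        rw [Real.one_le_exp_iff]
        have : (0 : ℝ) ≤ ν := by exact_mod_cast h0
        positivity
      have h4 : C * Real.exp (-ε * y) ≤ |C| :=
        (mul_le_mul_of_nonneg_right (le_abs_self C) (Real.exp_pos _).le).trans
          (mul_le_of_le_one_right (abs_nonneg C) h2)
      have h5 := mul_le_mul_of_nonneg_right h4 (Real.exp_pos (2 * Real.pi * ν * y)).le
      have h6 := le_mul_of_one_le_right (norm_nonneg (P ν)) h3
      have h7 := norm_le_norm_add_norm_sub' (fcoeff ν F y * expHeight ν y) (P ν)
      rw [add_mul]
      linarith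
    refine ⟨fcoeff ν F 1 * expHeight ν 1, 0, fun _ => rfl, fun h1 => absurd h1 h0.not_gt,
      fun y hy => ?_⟩
    rw [zero_mul, add_zero]
    refine hback (eq_of_hasDerivAt_zero_of_pos (f := fun y => fcoeff ν F y * expHeight ν y)
      (fun y hy => ?_) hy one_pos)
    exact (hA y hy).congr_deriv (by rw [hC, zero_mul])
  · obtain ⟨c, hc⟩ := eq_incGamma_of_hasDerivAt h0 hA (hP.tendsto_fcoeff hF j h0.le)
    exact ⟨P ν, c, fun h1 => absurd h0 h1.not_gt, fun _ => rfl, fun y hy => hback (hc y hy)⟩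

end Harmonic

end

noncomputable section

open scoped ComplexConjugate
open Filter Topology

/-! ### Expansions of components -/

theorem injective_intCast_add (q : ℚ) : Function.Injective fun j : ℤ => (j + q : ℚ) :=
  fun i j h => by simpa using h

theorem hasSum_coset_iff {q : ℚ} {t : ℚ → ℂ} {s : ℂ} (ht : ∀ n, t n ≠ 0 → ∃ j : ℤ, n = j + q) :
    HasSum (fun j : ℤ => t (j + q)) s ↔ HasSum t s :=
  (injective_intCast_add q).hasSum_iff fun n hn => by
    by_contra h
    obtain ⟨j, rfl⟩ := ht n h
    exact hn ⟨j, rfl⟩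

section Harmonic

variable {q : ℚ} {F : ℍ → ℂ} {n : ℕ}

theorem exists_component_maassExpansion {P : ℚ →₀ ℂ} (hF : SmoothOnH F) (h : QuasiPeriodic q F)
    (hu : ∀ τ, dz (dzb F) τ = n * invTwoIY τ * dzb F τ) (hP : HasGrowth q F P) :
    ∃ cp cm : ℚ → ℂ, (∀ ν, cp ν ≠ 0 → ∃ j : ℤ, ν = j + q) ∧ (∀ ν, cm ν ≠ 0 → ∃ j : ℤ, ν = j + q) ∧
      (∀ ν, cm ν ≠ 0 → ν < 0) ∧ (∀ ν < 0, cp ν = P ν) ∧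
      ∀ τ, ∃ a b : ℂ, HasSum (fun ν => cp ν * expTau ν τ) a ∧
        HasSum (fun ν => cm ν * (incGamma (n + 1) (4 * Real.pi * |(ν : ℝ)| * τ.im) : ℂ) *
          expTau ν τ) b ∧ F τ = a + b := by
  have key : ∀ ν : ℚ, ∃ cp cm : ℂ, (0 ≤ ν → cm = 0) ∧ (ν < 0 → cp = P ν) ∧
      (cp ≠ 0 ∨ cm ≠ 0 → ∃ j : ℤ, ν = j + q) ∧ ((∃ j : ℤ, ν = j + q) → ∀ y, 0 < y →
        fcoeff ν F y = (cp + cm * (incGamma (n + 1) (4 * Real.pi * |(ν : ℝ)| * y) : ℂ)) *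
          expHeight (-ν) y) := fun ν => by
    by_cases hj : ∃ j : ℤ, ν = j + q
    · obtain ⟨j, rfl⟩ := hj
      obtain ⟨cp, cm, h1, h2, h3⟩ := exists_fcoeff_eq hF h hu hP j
      exact ⟨cp, cm, h1, h2, fun _ => ⟨j, rfl⟩, fun _ => h3⟩
    · refine ⟨0, 0, fun _ => rfl, fun _ => ?_, fun h0 => by simp at h0, fun h1 => absurd h1 hj⟩
      by_contra h0
      exact hj (hP.1 ν (Ne.symm h0)).1
  choose cp cm hcm hcp hco hfc using key
  refine ⟨cp, cm, fun ν h0 => hco ν (Or.inl h0), fun ν h0 => hco ν (Or.inr h0),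
    fun ν h0 => lt_of_not_ge fun h1 => h0 (hcm ν h1), fun ν => hcp ν, fun τ => ?_⟩
  let Γ : ℚ → ℂ := fun ν => (incGamma (n + 1) (4 * Real.pi * |(ν : ℝ)| * τ.im) : ℂ)
  have hτ : ∀ ν, expTau ν τ = expHeight (-ν) τ.im * fchar ν τ.re := fun ν => by
    conv_lhs => rw [← pt_re_im τ]
    exact expTau_pt ν τ.re τ.im_pos
  have hT : HasSum (fun ν => (cp ν + cm ν * Γ ν) * expTau ν τ) (F τ) := by
    refine (hasSum_coset_iff (q := q) fun ν h0 => hco ν ?_).mp ?_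
    · by_contra! h1
      simp [h1.1, h1.2] at h0
    · have := hasSum_fcoeff hF h τ.im_pos τ.re
      rw [pt_re_im] at this
      refine this.congr_fun fun j => ?_
      rw [hfc _ ⟨j, rfl⟩ _ τ.im_pos, hτ]
      simp only [Γ]; ring
  -- So far only the combined series is known to converge. On ν ≥ 0 it coincides with the c⁺ part,
  -- since c⁻ vanishes there, and on ν < 0 the c⁺ part is the finite sum P.
  have hp : Summable fun ν => cp ν * expTau ν τ := by
    have h1 := hT.summable.indicator {ν | 0 ≤ ν}
    have h2 : Summable ({ν : ℚ | ν < 0}.indicator fun ν => P ν * expTau ν τ) := by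
      refine (summable_of_ne_finset_zero (s := P.support) fun ν hν => ?_).indicator _
      rw [Finsupp.notMem_support_iff.mp hν, zero_mul]
    refine (h1.add h2).congr fun ν => ?_
    rcases le_or_gt 0 ν with h0 | h0
    · rw [Set.indicator_of_mem (by exact h0), Set.indicator_of_notMem (by exact h0.not_gt), hcm ν h0]
      ring
    · rw [Set.indicator_of_notMem (by exact h0.not_ge), Set.indicator_of_mem (by exact h0), hcp ν h0]
      ring
  refine ⟨_, _, hp.hasSum, (hT.sub hp.hasSum).congr_fun fun ν => ?_, (add_sub_cancel _ _).symm⟩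
  simp only [Γ]; ring

/-- The mode ν of ∂^{i+1}F is 2πiν times that of ∂^iF minus that of ∂^i∂̄F, and the latter is a
multiple of E^i yⁿe^{2πνy}, negligible after multiplication by e^{2πνy} with ν < 0. This shows that
differentiation creates no principal terms beyond those of P. -/
theorem fcoeff_iterate_dz_mul_expHeight_tendsto {P : ℚ →₀ ℂ} (hF : SmoothOnH F)
    (h : QuasiPeriodic q F) (hu : ∀ τ, dz (dzb F) τ = n * invTwoIY τ * dzb F τ)
    (hP : HasGrowth q F P) {j : ℤ} (hj : (j + q : ℚ) < 0) (hPj : P (j + q) = 0) (i : ℕ) :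
    Tendsto (fun y => fcoeff (j + q) (dz^[i] F) y * expHeight (j + q) y) atTop (𝓝 0) := by
  obtain ⟨β, hβ⟩ := exists_fcoeff_dzb_eq hF h hu j
  induction i with
  | zero => simpa [hPj] using hP.tendsto_fcoeff hF j hj.le
  | succ i ih =>
    have hb : Tendsto (fun y => fcoeff (j + q) (dz^[i] (dzb F)) y * expHeight (j + q) y) atTop
        (𝓝 0) := by
      have h2 : (2 * (j + q : ℚ)) < 0 := by linarith
      have h3 := ((tendsto_pow_mul_expHeight n h2).const_mul β).norm
      rw [mul_zero, norm_zero] at h3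
      have h3' := h3.const_mul (n.descFactorial i : ℝ)
      rw [mul_zero] at h3'
      refine squeeze_zero_norm' ?_ h3'
      filter_upwards [eventually_ge_atTop 1] with y hy
      have hy0 : 0 < y := by linarith
      have h4 : fcoeff (j + q) (dz^[i] (dzb F)) y =
          n.descFactorial i * ((1 / (2 * Complex.I * y)) ^ i * fcoeff (j + q) (dzb F) y) := by
        rw [iterate_dz_of_dz_eq hF.dzb hu, fcoeff_const_mul, ← fcoeff_const_mul (F := dzb F)]
        simp only [fcoeff, invTwoIY, pt_im _ hy0]
      rw [h4, hβ y hy0]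
      -- The restriction to y ≥ 1 makes |E| ≤ 1.
      have h5 : ‖(1 / (2 * Complex.I * y) : ℂ) ^ i‖ ≤ 1 := by
        rw [norm_pow]
        refine pow_le_one₀ (norm_nonneg _) ?_
        rw [norm_div, norm_one, norm_mul, norm_mul, Complex.norm_I, Complex.norm_real,
          Complex.norm_ofNat, Real.norm_of_nonneg hy0.le, div_le_one (by linarith)]
        linarith
      calc _ = n.descFactorial i * (‖(1 / (2 * Complex.I * y) : ℂ) ^ i‖ *
            ‖β * ((y : ℂ) ^ n * expHeight (2 * (j + q)) y)‖) := by
            rw [two_mul (j + q : ℚ), expHeight_add (j + q) (j + q)]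
            simp only [norm_mul, Complex.norm_natCast]
            ring
        _ ≤ _ := mul_le_mul_of_nonneg_left
            (mul_le_of_le_one_left (norm_nonneg _) h5) (Nat.cast_nonneg _)
    have h1 := (ih.const_mul (2 * Real.pi * Complex.I * ((j + q : ℚ) : ℂ))).sub hb
    rw [mul_zero, sub_zero] at h1
    refine h1.congr' ?_
    filter_upwards [eventually_gt_atTop 0] with y hy
    have h2 := fcoeff_dz_add_dzb (hF.iterate_dz i) (h.iterate_dz hF i) j hy
    rw [dzb_iterate_dz hF] at h2
    rw [Function.iterate_succ_apply']
    linear_combination (-expHeight (j + q) y) * h2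

theorem fcoeff_of_dzb_eq_zero {G : ℍ → ℂ} (hG : SmoothOnH G) (h : QuasiPeriodic q G)
    (h0 : ∀ τ, dzb G τ = 0) (j : ℤ) {y : ℝ} (hy : 0 < y) :
    fcoeff (j + q) G y = fcoeff (j + q) G 1 * expHeight (j + q) 1 * expHeight (-(j + q)) y := by
  have hd : ∀ y, 0 < y → HasDerivAt (fun y => fcoeff (j + q) G y * expHeight (j + q) y) 0 y :=
    fun y hy => (hasDerivAt_fcoeff_mul_expHeight hG h j hy).congr_deriv (by
      simp [funext h0, fcoeff])
  rw [← eq_of_hasDerivAt_zero_of_pos hd hy one_pos, mul_assoc, expHeight_mul_neg, mul_one]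

theorem exists_component_fourierExpansion {P : ℚ →₀ ℂ} (hF : SmoothOnH F) (h : QuasiPeriodic q F)
    (hu : ∀ τ, dz (dzb F) τ = n * invTwoIY τ * dzb F τ) (hP : HasGrowth q F P) :
    ∃ c : ℚ → ℂ, (∀ ν, c ν ≠ 0 → ∃ j : ℤ, ν = j + q) ∧ (∀ ν < 0, c ν ≠ 0 → P ν ≠ 0) ∧
      ∀ τ, HasSum (fun ν => c ν * expTau ν τ) (dz^[n + 1] F τ) := by
  classical
  set G := dz^[n + 1] F with hGdef
  have hG : SmoothOnH G := hF.iterate_dz _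
  have hq : QuasiPeriodic q G := h.iterate_dz hF _
  have hG0 : ∀ τ, dzb G τ = 0 := fun τ => by
    rw [hGdef, dzb_iterate_dz hF, iterate_dz_eq_zero hF.dzb hu]
  let c : ℚ → ℂ := fun ν => if ∃ j : ℤ, ν = j + q then fcoeff ν G 1 * expHeight ν 1 else 0
  have hco : ∀ ν, c ν ≠ 0 → ∃ j : ℤ, ν = j + q := fun ν h0 => by
    by_contra h1
    exact h0 (if_neg h1)
  refine ⟨c, hco, fun ν hν h0 hP0 => ?_, fun τ => ?_⟩
  · obtain ⟨j, rfl⟩ := hco ν h0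
    -- For the holomorphic function G the mode times e^{2πνy} is constant in y, so its limit 0
    -- forces the coefficient itself to vanish.
    have h1 := fcoeff_iterate_dz_mul_expHeight_tendsto hF h hu hP hν hP0 (n + 1)
    refine h0 ?_
    simp only [c]
    rw [if_pos ⟨j, rfl⟩]
    refine tendsto_nhds_unique (tendsto_const_nhds.congr' ?_) h1
    filter_upwards [eventually_gt_atTop 0] with y hy
    rw [← hGdef, fcoeff_of_dzb_eq_zero hG hq hG0 j hy]
    linear_combination (-fcoeff (j + q) G 1 * expHeight (j + q) 1) * expHeight_mul_neg (j + q) y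
  · refine (hasSum_coset_iff (q := q) fun ν h0 => hco ν (left_ne_zero_of_mul h0)).mp ?_
    have := hasSum_fcoeff hG hq τ.im_pos τ.re
    rw [pt_re_im] at this
    refine this.congr_fun fun j => ?_
    conv_lhs => rw [← pt_re_im τ, expTau_pt _ _ τ.im_pos]
    simp only [c]
    rw [if_pos ⟨j, rfl⟩, fcoeff_of_dzb_eq_zero hG hq hG0 j τ.im_pos]
    ring

/-! ### The contribution of one pair of Fourier coefficients -/

theorem fcoeff_dzb_of_eq (hF : SmoothOnH F) (h : QuasiPeriodic q F) (j : ℤ) {X : ℝ → ℂ} {X' : ℂ}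
    {y : ℝ} (hy : 0 < y) (hX : ∀ y, 0 < y → fcoeff (j + q) F y = X y) (hX' : HasDerivAt X X' y) :
    fcoeff (j + q) (dzb F) y =
      Complex.I / 2 * (X' + 2 * Real.pi * ((j + q : ℚ) : ℂ) * X y) := by
  have h1 : HasDerivAt (fcoeff (j + q) F) X' y :=
    hX'.congr_of_eventuallyEq ((eventually_gt_nhds hy).mono fun z hz => hX z hz)
  have h2 := h1.unique (hasDerivAt_fcoeff' hF h j hy)
  rw [h2, hX y hy]
  linear_combination fcoeff (j + q) (dzb F) y * Complex.I_sq

theorem fcoeff_dz_of_eq (hF : SmoothOnH F) (h : QuasiPeriodic q F) (j : ℤ) {X : ℝ → ℂ} {X' : ℂ}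
    {y : ℝ} (hy : 0 < y) (hX : ∀ y, 0 < y → fcoeff (j + q) F y = X y) (hX' : HasDerivAt X X' y) :
    fcoeff (j + q) (dz F) y =
      Complex.I / 2 * (2 * Real.pi * ((j + q : ℚ) : ℂ) * X y - X') := by
  have h1 := fcoeff_dz_add_dzb hF h j hy
  rw [fcoeff_dzb_of_eq hF h j hy hX hX', hX y hy] at h1
  linear_combination h1

theorem fcoeff_raise (hF : SmoothOnH F) (κ : ℂ) (ν : ℚ) {y : ℝ} (hy : 0 < y) :
    fcoeff ν (raise κ F) y = fcoeff ν (dz F) y + κ / (2 * Complex.I * y) * fcoeff ν F y := by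
  have h1 : SmoothOnH fun z => κ * invTwoIY z * F z := (SmoothOnH.invTwoIY.const_mul κ).mul hF
  rw [← fcoeff_mul_invTwoIY_mul κ ν hy, ← fcoeff_add hF.dz h1 ν hy]
  rfl

/-- Raising preserves the shape p(1/y)e^{-2πνy}. This gives control of the raised coefficient as y →
∞ without computing p. -/
theorem exists_polynomial_fcoeff_raiseIter (hF : SmoothOnH F) (h : QuasiPeriodic q F) (j : ℤ)
    {c : ℂ} (hc : ∀ y, 0 < y → fcoeff (j + q) F y = c * expHeight (-(j + q)) y) (κ : ℂ) (i : ℕ) :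
    ∃ p : Polynomial ℂ, ∀ y, 0 < y → fcoeff (j + q) (raiseIter κ i F) y =
      p.eval ((y : ℂ)⁻¹) * expHeight (-(j + q)) y := by
  induction i with
  | zero => exact ⟨Polynomial.C c, fun y hy => by simpa [raiseIter] using hc y hy⟩
  | succ i ih =>
    obtain ⟨p, hp⟩ := ih
    -- With X = 1/y, the derivative ∂ contributes 2πiνp + (i/2)X²p', since d/dy = -X² d/dX, and the
    -- weight term contributes the multiple of Xp.
    refine ⟨Polynomial.C (2 * Real.pi * Complex.I * ((j + q : ℚ) : ℂ)) * p +
      Polynomial.C (Complex.I / 2) * Polynomial.X ^ 2 * Polynomial.derivative p +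
      Polynomial.C ((κ + 2 * i) / (2 * Complex.I)) * Polynomial.X * p, fun y hy => ?_⟩
    have hy' : (y : ℂ) ≠ 0 := by exact_mod_cast hy.ne'
    have hX : HasDerivAt (fun y : ℝ => p.eval ((y : ℂ)⁻¹) * expHeight (-(j + q)) y)
        (p.derivative.eval ((y : ℂ)⁻¹) * -((y : ℂ) ^ 2)⁻¹ * expHeight (-(j + q)) y +
          p.eval ((y : ℂ)⁻¹) * (2 * Real.pi * ((-(j + q) : ℚ) : ℂ) * expHeight (-(j + q)) y)) y :=
      (((p.hasDerivAt _).comp (y : ℂ) (hasDerivAt_inv hy')).comp_ofReal).mul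
        (hasDerivAt_expHeight _ y)
    rw [raiseIter, fcoeff_raise (hF.raiseIter κ i) _ _ hy, hp y hy,
      fcoeff_dz_of_eq (hF.raiseIter κ i) (h.raiseIter hF κ i) j hy hp hX]
    simp only [Polynomial.eval_add, Polynomial.eval_mul, Polynomial.eval_C, Polynomial.eval_pow,
      Polynomial.eval_X]
    push_cast
    field_simp
    ring

theorem tendsto_eval_inv (p : Polynomial ℂ) :
    Tendsto (fun y : ℝ => p.eval ((y : ℂ)⁻¹)) atTop (𝓝 (p.eval 0)) := by
  have h : Tendsto (fun y : ℝ => (y : ℂ)⁻¹) atTop (𝓝 0) := by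
    have := (Complex.continuous_ofReal.tendsto 0).comp tendsto_inv_atTop_zero
    rw [Complex.ofReal_zero] at this
    exact this.congr fun y => by simp
  exact (p.continuous.tendsto 0).comp h

/-- Closedness of ω mode by mode. For ν ≥ 0 the mode of ∂̄F vanishes and the first product is
already constant. For ν < 0 the left side has derivative zero in y; as y → ∞ the incomplete Gamma
term dies, and the second product tends to zero because both of its factors decay, so only c⁺(ν) C
is left. -/
theorem fcoeff_pairing {H : ℍ → ℂ} {P : ℚ →₀ ℂ} (hF : SmoothOnH F) (hqF : QuasiPeriodic q F)
    (huF : ∀ τ, dz (dzb F) τ = n * invTwoIY τ * dzb F τ)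
    (hH : SmoothOnH H) (hqH : QuasiPeriodic (-q) H)
    (huH : ∀ τ, dz (dzb H) τ = n * invTwoIY τ * dzb H τ) (hP : HasGrowth (-q) H P) (j : ℤ)
    {cp cm C : ℂ} (hcm : cm ≠ 0 → (j + q : ℚ) < 0)
    (hcF : ∀ y, 0 < y → fcoeff (j + q) F y =
      (cp + cm * (incGamma (n + 1) (4 * Real.pi * |((j + q : ℚ) : ℝ)| * y) : ℂ)) *
        expHeight (-(j + q)) y)
    (hC : ∀ y, 0 < y → fcoeff (-(j + q)) (dz^[n + 1] H) y = C * expHeight (j + q) y)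
    {y : ℝ} (hy : 0 < y) :
    fcoeff (j + q) F y * fcoeff (-(j + q)) (dz^[n + 1] H) y +
      fcoeff (j + q) (dzb F) y * fcoeff (-(j + q)) (raiseIter (-n) n H) y = cp * C := by
  have hA := fun y (hy : 0 < y) => hasDerivAt_fcoeff_mul_expHeight hF hqF j hy
  have hμ : -(j + q : ℚ) = (-j : ℤ) + -q := by push_cast; ring
  set ν : ℚ := j + q with hν
  have hexp := expHeight_mul_neg ν
  rcases le_or_gt 0 ν with h0 | h0
  · have hcm0 : cm = 0 := by
      by_contra h1
      exact absurd (hcm h1) h0.not_gt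
    have hb : fcoeff ν (dzb F) y = 0 := by
      rw [hν, fcoeff_dzb_of_eq (X := fun y => cp * expHeight (-ν) y) hF hqF j hy
        (fun y hy => by rw [← hν, hcF y hy, hcm0]; ring)
        ((hasDerivAt_expHeight (-ν) y).const_mul cp), ← hν]
      push_cast; ring
    rw [hb, hcF y hy, hC y hy, hcm0]
    linear_combination cp * C * hexp y
  · set G := raiseIter (-n) n H with hGdef
    have hG : SmoothOnH G := hH.raiseIter _ _
    have hqG : QuasiPeriodic (-q) G := hqH.raiseIter hH _ _
    have hbol : raise n G = dz^[n + 1] H := by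
      rw [← raiseIter_eq_iterate_dz hH, raiseIter, hGdef]
      congr 2 <;> push_cast <;> ring
    obtain ⟨β, hβ⟩ := exists_fcoeff_dzb_eq hF hqF huF j
    rw [← hν] at hβ
    obtain ⟨dp, dm, hdm, -, hd⟩ := exists_fcoeff_eq hH hqH huH hP (-j)
    -- The dual mode -ν is positive, so H has no incomplete Gamma term there and its coefficient is
    -- a pure exponential.
    have hdm0 : dm = 0 := hdm (by rw [← hμ]; linarith)
    obtain ⟨p, hp⟩ := exists_polynomial_fcoeff_raiseIter hH hqH (-j) (c := dp)
      (fun y hy => by rw [hd y hy, hdm0]; ring) (-n) n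
    rw [← hμ, ← hGdef] at hp
    rw [neg_neg] at hp
    -- Bol's identity R_n G = ∂^{n+1}H, read on the mode -ν, as a differential equation in y.
    have hr : ∀ y : ℝ, 0 < y → HasDerivAt (fcoeff (-ν) G) (-(2 * Real.pi * (ν : ℂ)) * fcoeff (-ν) G y
        + 2 * Complex.I * (C * expHeight ν y) - n / y * fcoeff (-ν) G y) y := fun y hy => by
      have h1 := hasDerivAt_fcoeff' hG hqG (-j) hy
      have h2 := fcoeff_dz_add_dzb hG hqG (-j) hy
      have h3 := fcoeff_raise hG n (-ν) hy
      rw [← hμ] at h1 h2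
      rw [hbol, hC y hy] at h3
      refine h1.congr_deriv ?_
      have hy' : (y : ℂ) ≠ 0 := by exact_mod_cast hy.ne'
      have h4 : (n : ℂ) / (2 * Complex.I * y) = -Complex.I / 2 * (n / y) := by
        field_simp; simp
      rw [h4] at h3
      push_cast at h2 ⊢
      linear_combination -2 * Complex.I * h2 - 2 * Complex.I * h3 +
        (4 * Real.pi * (ν : ℂ) + n / y) * fcoeff (-ν) G y * Complex.I_sq
    have hb : ∀ y : ℝ, 0 < y → HasDerivAt (fcoeff ν (dzb F))
        ((2 * Real.pi * (ν : ℂ) + n / y) * fcoeff ν (dzb F) y) y := fun y hy =>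
      hasDerivAt_fcoeff_dzb hF hqF huF j hy
    let W : ℝ → ℂ := fun y => fcoeff ν F y * expHeight ν y * C +
      fcoeff ν (dzb F) y * fcoeff (-ν) G y
    have hW : ∀ y, 0 < y → HasDerivAt W 0 y := fun y hy => by
      refine (((hA y hy).mul_const C).add ((hb y hy).mul (hr y hy))).congr_deriv ?_
      ring
    have hlim : Tendsto W atTop (𝓝 (cp * C)) := by
      have hs : 0 < 4 * Real.pi * |(ν : ℝ)| := by
        have : 0 < |(ν : ℝ)| := abs_pos.mpr (by exact_mod_cast h0.ne)
        positivity
      have h1 := ((((tendsto_incGamma_mul (a := n + 1) (by positivity) hs).const_mul cm).const_add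
        cp).mul_const C).add (((tendsto_pow_mul_expHeight n h0).const_mul β).mul
        ((tendsto_eval_inv p).mul (tendsto_expHeight h0)))
      simp only [mul_zero, add_zero] at h1
      refine h1.congr' ?_
      filter_upwards [eventually_gt_atTop 0] with y hy
      simp only [W]
      rw [hcF y hy, hp y hy, hβ y hy]
      linear_combination (-(cp + cm * (incGamma (n + 1) (4 * Real.pi * |(ν : ℝ)| * y) : ℂ)) * C) *
        hexp y
    have := eq_of_hasDerivAt_zero_of_tendsto hW hlim hy
    rw [← this, hC y hy]
    simp only [W]; ring

end Harmonic

end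

noncomputable section

open Filter Topology

/-! ### Vector valued forms -/

/-- Modularity is indexed by the metaplectic group, whereas invariance of ω is needed for every
matrix; a lift exists because S and T generate SL₂(ℤ). -/
theorem Mp2Z.exists_mat_eq (M : SL(2, ℤ)) : ∃ g : Mp2Z, g.mat = M := by
  let π : Mp2Z →* SL(2, ℤ) := ⟨⟨Mp2Z.mat, rfl⟩, fun _ _ => rfl⟩
  have h : (Subgroup.closure {Mp2Z.S, Mp2Z.T}).map π = ⊤ := by
    rw [MonoidHom.map_closure, Set.image_pair]
    exact SpecialLinearGroup.SL2Z_generators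
  obtain ⟨g, -, hg⟩ : M ∈ (Subgroup.closure {Mp2Z.S, Mp2Z.T}).map π := by rw [h]; trivial
  exact ⟨g, hg⟩

section Vector

variable {D : Type*}

/-- The properties of the components of a harmonic weak Maass form of weight `-n`. -/
structure IsHarmonicVector (q : D → ℚ) (n : ℕ) (F : ℍ → D → ℂ) (P : D → ℚ →₀ ℂ) : Prop where
  smooth : ∀ γ, SmoothOnH fun z => F z γ
  quasiPeriodic : ∀ γ, QuasiPeriodic (q γ) fun z => F z γ
  dz_dzb : ∀ γ τ, dz (dzb fun z => F z γ) τ = n * invTwoIY τ * dzb (fun z => F z γ) τ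
  growth : ∀ γ, HasGrowth (q γ) (fun z => F z γ) (P γ)

theorem TransformsBy.quasiPeriodic [Fintype D] [DecidableEq D] {q : D → ℚ} {k : ℤ} {F : ℍ → D → ℂ}
    (h : TransformsBy ModularGroup.T (Matrix.diagonal fun γ => expUnit (q γ)) k F) (γ : D) :
    QuasiPeriodic (q γ) fun z => F z γ := fun τ => by
  beta_reduce
  rw [h τ γ, QuasiPeriodic.denom_T, one_zpow, one_mul, Matrix.mulVec_diagonal]

theorem IsHarmonicMaass.exists_isHarmonicVector [Fintype D] [DecidableEq D]
    {R : Mp2Z → Matrix D D ℂ → Prop} {q : D → ℚ} {n : ℕ} {F : ℍ → D → ℂ}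
    (h : IsHarmonicMaass R q (-n) F)
    (hT : R Mp2Z.T (Matrix.diagonal fun γ => expUnit (q γ))) : ∃ P, IsHarmonicVector q n F P := by
  obtain ⟨P, hP, ε, hε, hO⟩ := h.growth
  refine ⟨P, h.smooth, (isModular_iff.mp h.modular _ _ hT).quasiPeriodic, fun γ τ => ?_,
    fun γ => ⟨hP γ, ε, hε, hO γ⟩⟩
  rw [dz_dzb_of_hypLaplacian_eq_zero (h.smooth γ) (h.harmonic γ)]
  push_cast; ring

namespace IsHarmonicVector

variable {q : D → ℚ} {n : ℕ} {F : ℍ → D → ℂ} {P : D → ℚ →₀ ℂ}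

theorem exists_le_of_ne_zero [Fintype D] (P : D → ℚ →₀ ℂ) :
    ∃ N : ℚ, N ≤ 0 ∧ ∀ γ ν, P γ ν ≠ 0 → N ≤ ν := by
  classical
  -- Inserting 0 gives N ≤ 0, so that N also serves as a lower bound for nonnegative exponents.
  obtain ⟨N, hN⟩ := (insert 0 (Finset.univ.biUnion fun γ => (P γ).support)).bddBelow
  refine ⟨N, hN (by simp), fun γ ν h => hN ?_⟩
  simp only [Finset.coe_insert, Finset.coe_biUnion]
  exact Or.inr (Set.mem_biUnion (Finset.mem_coe.mpr (Finset.mem_univ γ)) (by simpa using h))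

theorem exists_maassExpansion [Fintype D] (h : IsHarmonicVector q n F P) :
    ∃ cp cm, HasMaassExpansion q (-n) F cp cm := by
  choose cp cm h1 h2 h3 h4 h5 using fun γ => exists_component_maassExpansion (h.smooth γ)
    (h.quasiPeriodic γ) (h.dz_dzb γ) (h.growth γ)
  obtain ⟨N, hN0, hN⟩ := exists_le_of_ne_zero P
  refine ⟨cp, cm, h1, ⟨N, fun γ ν h0 => ?_⟩, h2, h3, fun τ γ => ?_⟩
  · rcases le_or_gt 0 ν with hν | hν
    · exact hN0.trans hν
    · exact hN γ ν (by rwa [← h4 γ ν hν])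
  · have := h5 γ τ
    rwa [show (n + 1 : ℝ) = ((1 - -(n : ℤ) : ℤ) : ℝ) by push_cast; ring] at this

theorem iterate_opD (h : ∀ γ, SmoothOnH fun z => F z γ) (i : ℕ) :
    opD^[i] F = fun τ γ => (1 / (2 * Real.pi * Complex.I)) ^ i * dz^[i] (fun z => F z γ) τ := by
  induction i with
  | zero => simp
  | succ i ih =>
    rw [Function.iterate_succ_apply', ih]
    funext τ γ
    change 1 / (2 * Real.pi * Complex.I) * dz (fun z => (1 / (2 * Real.pi * Complex.I)) ^ i *
      dz^[i] (fun z => F z γ) z) τ = _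
    rw [dz_const_mul _ ((h γ).iterate_dz i), Function.iterate_succ_apply']
    ring

/-- Holomorphy holds because ∂^{n+1} kills ∂̄F, modularity because Bol's identity makes ∂^{n+1} an
iterated raising operator from weight -n to n + 2, and finiteness of the principal part is inherited
from P. -/
theorem isWeaklyHolomorphic [Fintype D] {R : Mp2Z → Matrix D D ℂ → Prop}
    (h : IsHarmonicVector q n F P)
    (hmod : IsModular R (-n) F) :
    IsWeaklyHolomorphic R q (2 - -n) (opD^[n + 1] F) := by
  rw [iterate_opD h.smooth]
  set c : ℂ := (1 / (2 * Real.pi * Complex.I)) ^ (n + 1)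
  refine ⟨fun γ => mdifferentiable_of_dzb_eq_zero (((h.smooth γ).iterate_dz _).const_mul c)
    fun τ => ?_, isModular_iff.mpr fun g A hA => ?_, ?_⟩
  · rw [dzb_const_mul _ ((h.smooth γ).iterate_dz _), dzb_iterate_dz (h.smooth γ),
      iterate_dz_eq_zero (h.smooth γ).dzb (h.dz_dzb γ), mul_zero]
  · have h1 := (isModular_iff.mp hmod g A hA).raiseIter_apply h.smooth (n + 1)
    have h2 : ∀ τ γ, raiseIter ((-n : ℤ) : ℂ) (n + 1) (fun z => F z γ) τ =
        dz^[n + 1] (fun z => F z γ) τ := fun τ γ => by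
      rw [← raiseIter_eq_iterate_dz (h.smooth γ)]
      congr 1; push_cast; ring
    simp only [h2] at h1
    rw [show (-n + 2 * (n + 1 : ℕ) : ℤ) = 2 - -n by push_cast; ring] at h1
    exact h1.const_mul c
  · choose a h1 h2 h3 using fun γ => exists_component_fourierExpansion (h.smooth γ)
      (h.quasiPeriodic γ) (h.dz_dzb γ) (h.growth γ)
    obtain ⟨N, hN0, hN⟩ := exists_le_of_ne_zero P
    refine ⟨fun γ ν => c * a γ ν, fun γ ν h0 => h1 γ ν (right_ne_zero_of_mul h0),
      ⟨N, fun γ ν h0 => ?_⟩, fun τ γ => ?_⟩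
    · rcases le_or_gt 0 ν with hν | hν
      · exact hN0.trans hν
      · exact hN γ ν (h2 γ ν hν (right_ne_zero_of_mul h0))
    · exact ((h3 γ τ).mul_left c).congr_fun fun ν => by ring

/-- Uniqueness of Fourier coefficients ties any given decomposition to the integrals, so the final
identity covers every decomposition and not only the constructed one. -/
theorem fcoeff_of_maassExpansion {cp cm : D → ℚ → ℂ} (h : HasMaassExpansion q (-n) F cp cm) (γ : D)
    (j : ℤ) {y : ℝ} (hy : 0 < y) : fcoeff (j + q γ) (fun z => F z γ) y =
      (cp γ (j + q γ) + cm γ (j + q γ) *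
        (incGamma (n + 1) (4 * Real.pi * |((j + q γ : ℚ) : ℝ)| * y) : ℂ)) *
          expHeight (-(j + q γ)) y := by
  refine fcoeff_eq_of_hasSum (a := fun ν => (cp γ ν + cm γ ν *
    (incGamma (n + 1) (4 * Real.pi * |(ν : ℝ)| * y) : ℂ)) * expHeight (-ν) y) (fun ν h0 => ?_)
    (fun x => ?_) j
  · by_cases h1 : cp γ ν = 0
    · refine h.suppCoset_neg γ ν fun h2 => ?_
      simp [h1, h2] at h0
    · exact h.suppCoset_pos γ ν h1
  · obtain ⟨a, b, ha, hb, hab⟩ := h.expansion (pt x y) γ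
    rw [hab]
    rw [show ((1 - -(n : ℤ) : ℤ) : ℝ) = (n + 1 : ℝ) by push_cast; ring] at hb
    refine (ha.add hb).congr_fun fun ν => ?_
    rw [expTau_pt ν x hy, pt_im x hy]
    ring

theorem fcoeff_of_fourierExpansion {G : ℍ → D → ℂ} {c : D → ℚ → ℂ} (h : HasFourierExpansion q G c)
    (γ : D) (j : ℤ) {y : ℝ} (hy : 0 < y) : fcoeff (j + q γ) (fun z => G z γ) y =
      c γ (j + q γ) * expHeight (-(j + q γ)) y := by
  refine fcoeff_eq_of_hasSum (a := fun ν => c γ ν * expHeight (-ν) y)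
    (fun ν h0 => h.suppCoset γ ν (left_ne_zero_of_mul h0)) (fun x => ?_) j
  refine (h.hasSum (pt x y) γ).congr_fun fun ν => ?_
  rw [expTau_pt ν x hy]
  ring

/-- The indices lie in one coset of ℤ and are bounded on both sides. Without this finiteness `∑ᶠ`
could take its default value 0. -/
theorem finite_support_mul {cp c : D → ℚ → ℂ} (h1 : SuppCoset q cp)
    (h2 : SuppBddBelow cp) (h3 : SuppBddBelow c) (γ : D) :
    (Function.support fun m => cp γ m * c γ (-m)).Finite := by
  obtain ⟨N, hN⟩ := h2
  obtain ⟨N', hN'⟩ := h3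
  refine ((Set.finite_Icc (⌈N - q γ⌉) (⌊-N' - q γ⌋)).image fun j : ℤ => (j + q γ : ℚ)).subset
    fun m hm => ?_
  have hm1 := left_ne_zero_of_mul hm
  have hm2 := right_ne_zero_of_mul hm
  obtain ⟨j, rfl⟩ := h1 γ m hm1
  refine ⟨j, ⟨Int.ceil_le.mpr ?_, Int.le_floor.mpr ?_⟩, rfl⟩
  · linarith [hN γ _ hm1]
  · linarith [hN' γ _ hm2]

/-- Parseval turns the vanishing integral into a sum of mode contributions, each evaluated by
`fcoeff_pairing`. The height y = 1 is arbitrary, since every contribution is independent of y. -/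
theorem sum_finsum_eq_zero [Fintype D] [DecidableEq D] {f h : ℍ → D → ℂ} {Pf Ph : D → ℚ →₀ ℂ}
    (hf : IsHarmonicVector q n f Pf) (hh : IsHarmonicVector (fun γ => -q γ) n h Ph)
    (hmod : ∀ M : SL(2, ℤ), ∃ A A' : Matrix D D ℂ, A.transpose * A' = 1 ∧
      TransformsBy M A (-n) f ∧ TransformsBy M A' (-n) h) {cp cm cg : D → ℚ → ℂ}
    (hcf : HasMaassExpansion q (-n) f cp cm)
    (hcg : HasFourierExpansion (fun γ => -q γ) (opD^[n + 1] h) cg) :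
    ∑ γ, ∑ᶠ m : ℚ, cp γ m * cg γ (-m) = 0 := by
  set c : ℂ := (1 / (2 * Real.pi * Complex.I)) ^ (n + 1) with hc
  have hc0 : c ≠ 0 := pow_ne_zero _ (one_div_ne_zero Complex.two_pi_I_ne_zero)
  rw [iterate_opD hh.smooth, ← hc] at hcg
  -- The factor c, a power of 1/(2πi), accounts for the difference between D^{n+1} and ∂^{n+1}.
  have hC : ∀ γ (j : ℤ) (y : ℝ), 0 < y → fcoeff (-(j + q γ)) (dz^[n + 1] fun z => h z γ) y =
      c⁻¹ * cg γ (-(j + q γ)) * expHeight (j + q γ) y := fun γ j y hy => by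
    have h1 := fcoeff_of_fourierExpansion hcg γ (-j) hy
    rw [fcoeff_const_mul, show ((-j : ℤ) : ℚ) + -q γ = -(j + q γ) by push_cast; ring, neg_neg] at h1
    rw [mul_assoc, ← h1, inv_mul_cancel_left₀ hc0]
  have hsum : ∀ γ, HasSum (fun j : ℤ => cp γ (j + q γ) * (c⁻¹ * cg γ (-(j + q γ))))
      ((∫ x in (0 : ℝ)..1, f (pt x 1) γ * dz^[n + 1] (fun z => h z γ) (pt x 1)) +
        ∫ x in (0 : ℝ)..1, dzb (fun z => f z γ) (pt x 1) *
          raiseIter (-n) n (fun z => h z γ) (pt x 1)) := fun γ => by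
    refine ((hasSum_fcoeff_mul_fcoeff (hf.smooth γ) (hf.quasiPeriodic γ)
      ((hh.smooth γ).iterate_dz (n + 1)) one_pos).add
      (hasSum_fcoeff_mul_fcoeff (hf.smooth γ).dzb ((hf.quasiPeriodic γ).dz_dzb (hf.smooth γ)).2
        ((hh.smooth γ).raiseIter (-n) n) one_pos)).congr_fun fun j => ?_
    exact (fcoeff_pairing (hf.smooth γ) (hf.quasiPeriodic γ) (hf.dz_dzb γ) (hh.smooth γ)
      (hh.quasiPeriodic γ) (hh.dz_dzb γ) (hh.growth γ) j
      (hcf.neg_of_ne_zero γ _) (fun y hy => fcoeff_of_maassExpansion hcf γ j hy) (hC γ j)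
      one_pos).symm
  have hfin : ∀ γ, ∑ᶠ m : ℚ, cp γ m * cg γ (-m) =
      c * ((∫ x in (0 : ℝ)..1, f (pt x 1) γ * dz^[n + 1] (fun z => h z γ) (pt x 1)) +
        ∫ x in (0 : ℝ)..1, dzb (fun z => f z γ) (pt x 1) *
          raiseIter (-n) n (fun z => h z γ) (pt x 1)) := fun γ => by
    rw [← tsum_eq_finsum (L := .unconditional ℚ)
      (finite_support_mul hcf.suppCoset_pos hcf.bddBelow_pos hcg.bddBelow γ)]
    refine HasSum.tsum_eq ((hasSum_coset_iff (q := q γ) fun m hm =>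
      hcf.suppCoset_pos γ m (left_ne_zero_of_mul hm)).mp
      (((hsum γ).mul_left c).congr_fun fun j => ?_))
    field_simp
  have hint := integral_pairing_eq_zero hf.smooth hh.smooth hf.dz_dzb hh.dz_dzb hmod one_pos
  have hi1 : ∀ γ, IntervalIntegrable (fun x => f (pt x 1) γ *
      dz^[n + 1] (fun z => h z γ) (pt x 1)) MeasureTheory.volume 0 1 := fun γ =>
    (((hf.smooth γ).mul ((hh.smooth γ).iterate_dz (n + 1))).continuous_pt
      one_pos).intervalIntegrable _ _
  have hi2 : ∀ γ, IntervalIntegrable (fun x => dzb (fun z => f z γ) (pt x 1) *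
      raiseIter (-n) n (fun z => h z γ) (pt x 1)) MeasureTheory.volume 0 1 := fun γ =>
    (((hf.smooth γ).dzb.mul ((hh.smooth γ).raiseIter (-n) n)).continuous_pt
      one_pos).intervalIntegrable _ _
  have hs1 := intervalIntegral.integral_finsetSum (s := Finset.univ) fun γ _ => hi1 γ
  have hs2 := intervalIntegral.integral_finsetSum (s := Finset.univ) fun γ _ => hi2 γ
  have hI1 := IntervalIntegrable.sum Finset.univ fun γ _ => hi1 γ
  have hI2 := IntervalIntegrable.sum Finset.univ fun γ _ => hi2 γ
  simp only [Finset.sum_fn] at hI1 hI2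
  rw [intervalIntegral.integral_add hI1 hI2, hs1, hs2, ← Finset.sum_add_distrib] at hint
  rw [Finset.sum_congr rfl fun γ _ => hfin γ, ← Finset.mul_sum, hint, mul_zero]

end IsHarmonicVector

end Vector

/-! ### Duality of ρ_L and ρ̄_L. -/

namespace EvenLattice

variable {V : Type*} [AddCommGroup V] [Module ℚ V] (Λ : EvenLattice V)

theorem weilRel_T : Λ.WeilRel Mp2Z.T (Matrix.diagonal fun γ => expUnit (Λ.q γ)) :=
  ⟨Λ.weilT, Subgroup.subset_closure (by simp), rfl⟩

theorem dualWeilRel_T : Λ.DualWeilRel Mp2Z.T (Matrix.diagonal fun γ => expUnit (-Λ.q γ)) := by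
  refine ⟨Λ.weilT, Subgroup.subset_closure (by simp), ?_⟩
  change _ = (star (Matrix.diagonal fun γ => expUnit (Λ.q γ))).transpose
  rw [Matrix.star_eq_conjTranspose, Matrix.diagonal_conjTranspose, Matrix.diagonal_transpose]
  exact congrArg _ (funext fun γ => expUnit_neg _)

/-- The same unitary U serves both relations, with A' = (U⁻¹)ᵗ. Modularity is assumed for every
matrix in the relation, so existence of such a U suffices and its uniqueness plays no role. -/
theorem exists_weilRel_dualWeilRel (g : Mp2Z) : ∃ A A', A.transpose * A' = 1 ∧
    Λ.WeilRel g A ∧ Λ.DualWeilRel g A' := by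
  obtain ⟨U, hU⟩ := Λ.exists_mem_weilGraph g
  refine ⟨_, _, ?_, ⟨U, hU, rfl⟩, ⟨U, hU, rfl⟩⟩
  rw [← Matrix.transpose_mul]
  have : ((U⁻¹ : Matrix.unitaryGroup Λ.Disc ℂ) : Matrix Λ.Disc Λ.Disc ℂ) * U = 1 :=
    congrArg Subtype.val (inv_mul_cancel U)
  rw [this, Matrix.transpose_one]

end EvenLattice

end

theorem mainTheorem2 {V : Type*} [AddCommGroup V] [Module ℚ V] (Λ : EvenLattice V)
    (k : ℤ) (hk : k ≤ 0) (f g : ℍ → Λ.Disc → ℂ) (hf : f ∈ Λ.H k)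
    (hg : g ∈ opD^[(1 - k).toNat] '' Λ.HDual k) :
    g ∈ Λ.MDual (2 - k) ∧
    (∃ cp cm, HasMaassExpansion Λ.q k f cp cm) ∧
    ∀ cp cm cg, HasMaassExpansion Λ.q k f cp cm →
      HasFourierExpansion (fun γ => -Λ.q γ) g cg →
      ∑ γ, ∑ᶠ m : ℚ, cp γ m * cg γ (-m) = 0 := by
  obtain ⟨n, rfl⟩ : ∃ n : ℕ, k = -n := ⟨(-k).toNat, by omega⟩
  obtain ⟨h, hh, rfl⟩ := hg
  rw [show (1 - -(n : ℤ)).toNat = n + 1 by omega]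
  obtain ⟨Pf, hPf⟩ := IsHarmonicMaass.exists_isHarmonicVector hf Λ.weilRel_T
  obtain ⟨Ph, hPh⟩ := IsHarmonicMaass.exists_isHarmonicVector hh Λ.dualWeilRel_T
  refine ⟨hPh.isWeaklyHolomorphic hh.modular, hPf.exists_maassExpansion, fun cp cm cg hcf hcg =>
    hPf.sum_finsum_eq_zero hPh (fun M => ?_) hcf hcg⟩
  obtain ⟨g, rfl⟩ := Mp2Z.exists_mat_eq M
  obtain ⟨A, A', hA, h1, h2⟩ := Λ.exists_weilRel_dualWeilRel g
  exact ⟨A, A', hA, isModular_iff.mp hf.modular g A h1, isModular_iff.mp hh.modular g A' h2⟩
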